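/- Let $M$ be a (complex analytic) Frobenius manifold of dimension $n\ge 1$ and charge $d\in\mathbb C$, $d\neq 1$, with metric $\langle\ ,\ \rangle$, multiplication $\cdot$ of tangent vectors, unity $e$ and Euler vector field $E$ (so that $\mathrm{Lie}_E(\cdot)=\cdot$ and $\mathrm{Lie}_E\langle\ ,\ \rangle=(2-d)\langle\ ,\ \rangle$). Let $t^1,\dots,t^n$ be local flat coordinates of $\langle\ ,\ \rangle$ with $e=\partial/\partial t^1$, let $\eta_{\alpha\beta}=\langle\partial/\partial t^\alpha,\partial/\partial t^\beta\rangle$ and $t_1=\sum_\alpha\eta_{1\alpha}t^\alpha$. The intersection form on $T^*M$ is $(\omega_1,\omega_2)=i_E(\omega_1\cdot\omega_2)$, where 1-forms are multiplied through the isomorphism $TM\simeq T^*M$ given by $\langle\ ,\ \rangle$; the discriminant $\Sigma\subset M$ is the set where it degenerates. On $M\setminus\Sigma$ let $(\ ,\ )$ also denote the inverse form on tangent vectors, $\nabla_*$ its Levi-Civita connection, and $u*v=E^{-1}\cdot u\cdot v$. A twisted period with parameter $\nu\in\mathbb C$ is a holomorphic function $\tilde p$ on an open subset of $M\setminus\Sigma$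 with $$(\nabla_* d\tilde p)(u,v)=\nu\, d\tilde p(u*v)\quad\text{for all tangent vectors } u,v .$$ Let $\nu\neq\frac{1-d}{2}$, and let $z^1,\dots,z^n$ be $n$ independent twisted periods with parameter $\nu$, used as local coordinates on an open subset $\Omega$ of $M\setminus\Sigma$ contained in the domain of $t^1,\dots,t^n$. Put $$f(z)=\Big[\tfrac{1-d}{2}-\nu\Big]^{-1}t_1,$$ where $t_1$ is expressed as a function of $z$. Then $f$ is holomorphic and the Gram matrix of the intersection form on tangent vectors is the Hessian of $f$: $$\Big(\frac{\partial}{\partial z^i},\frac{\partial}{\partial z^j}\Big)=\frac{\partial^2 f(z)}{\partial z^i\,\partial z^j},\qquad i,j=1,\dots,n .$$ Moreover, if $\Omega$ is connected, then a constant can be added to $t_1$ so that $\mathrm{Lie}_E t_1=(1-d)t_1$ on $\Omega$ and, if $\frac{1-d}{2}+\nu\neq0$, constants can be added to the $z^i$ so that $\mathrm{Lie}_E z^i=\big(\frac{1-d}{2}+\nu\big)z^i$ on $\Omega$. If $\frac{1-d}{2}+\nu\neq 0$ and $t_1$ and the $z^i$ are so normalized, then $f$ is homogeneous in $z$ of degree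 $$\deg f=\frac{1-d}{\frac{1-d}{2}+\nu},$$ that is, $f(e^{\tau}z)=e^{\tau\deg f}f(z)$ whenever $\tau\in\mathbb C$ and the path $e^{s\tau}z$, $0\le s\le 1$, stays in the image of $\Omega$ under the coordinates $z$. -/

import Mathlib

open scoped Manifold ContDiff

namespace FrobeniusGeometry

noncomputable section

/-- The model space `ℂⁿ` of an `n`-dimensional complex manifold. -/
abbrev Model (n : ℕ) : Type := Fin n → ℂ

/-- The tangent space of a complex manifold of dimension `n` at `x`. -/
abbrev Tan (n : ℕ) {M : Type*} [TopologicalSpace M] [ChartedSpace (Model n) M] (x : M) : Type :=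
  TangentSpace 𝓘(ℂ, Model n) x

instance instFiniteDimensionalTan (n : ℕ) {M : Type*} [TopologicalSpace M]
    [ChartedSpace (Model n) M] (x : M) : FiniteDimensional ℂ (Tan n x) :=
  inferInstanceAs (FiniteDimensional ℂ (Fin n → ℂ))

/-- The partial derivative `∂ f / ∂ y^α` of a function of `n` complex variables. -/
def pd {n : ℕ} (α : Fin n) (f : Model n → ℂ) (y : Model n) : ℂ :=
  fderiv ℂ f y (Pi.single α 1)

section Components

variable {n : ℕ} {M : Type*} [TopologicalSpace M] [ChartedSpace (Model n) M]

/-- The holomorphic charts (local coordinate systems) of `M`. -/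
def IsHolChart (χ : OpenPartialHomeomorph M (Model n)) : Prop :=
  χ ∈ IsManifold.maximalAtlas 𝓘(ℂ, Model n) ω M

/-- The coordinate vector `∂ / ∂ y^α` of the chart `χ`, at the point with coordinates `y`. -/
def coordVec (χ : OpenPartialHomeomorph M (Model n)) (y : Model n) (α : Fin n) :
    Tan n (χ.symm y) :=
  mfderiv 𝓘(ℂ, Model n) 𝓘(ℂ, Model n) χ.symm y (Pi.single α (1 : ℂ) : Fin n → ℂ)

/-- The differential `d y^α` of a coordinate of the chart `χ`, at the point `x`. -/
def coordDiff (χ : OpenPartialHomeomorph M (Model n)) (x : M) (α : Fin n) :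
    Module.Dual ℂ (Tan n x) :=
  (LinearMap.proj α : (Fin n → ℂ) →ₗ[ℂ] ℂ) ∘ₗ
    (mfderiv 𝓘(ℂ, Model n) 𝓘(ℂ, Model n) χ x : Tan n x →L[ℂ] (Fin n → ℂ)).toLinearMap

/-- The components `V^α(y)` of a vector field in the chart `χ`. -/
def vecComp (V : (x : M) → Tan n x) (χ : OpenPartialHomeomorph M (Model n)) (α : Fin n)
    (y : Model n) : ℂ :=
  coordDiff χ (χ.symm y) α (V (χ.symm y))

/-- The components `h_{αβ}(y)` of a bilinear form on the tangent bundle in the chart `χ`. -/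
def gram (h : (x : M) → LinearMap.BilinForm ℂ (Tan n x))
    (χ : OpenPartialHomeomorph M (Model n)) (α β : Fin n) (y : Model n) : ℂ :=
  h (χ.symm y) (coordVec χ y α) (coordVec χ y β)

/-- The structure constants `c_{αβ}^γ(y)` of a multiplication of tangent vectors in the
chart `χ`: `∂_α · ∂_β = c_{αβ}^γ ∂_γ`. -/
def structConst (m : (x : M) → Tan n x →ₗ[ℂ] Tan n x →ₗ[ℂ] Tan n x)
    (χ : OpenPartialHomeomorph M (Model n)) (α β γ : Fin n) (y : Model n) : ℂ :=
  coordDiff χ (χ.symm y) γ (m (χ.symm y) (coordVec χ y α) (coordVec χ y β))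

/-- The components `c_{αβγ}(y)` of the 3-tensor `c(u,v,w) = h(u · v, w)` in the chart `χ`. -/
def lowerConst (h : (x : M) → LinearMap.BilinForm ℂ (Tan n x))
    (m : (x : M) → Tan n x →ₗ[ℂ] Tan n x →ₗ[ℂ] Tan n x)
    (χ : OpenPartialHomeomorph M (Model n)) (α β γ : Fin n) (y : Model n) : ℂ :=
  h (χ.symm y) (m (χ.symm y) (coordVec χ y α) (coordVec χ y β)) (coordVec χ y γ)

/-- Flat coordinates of a metric: the Gram matrix of the metric in these coordinates is constant.
In such coordinates the covariant derivatives of tensors along the coordinate vectors (for the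
Levi-Civita connection of the metric) are the partial derivatives of their components. -/
def IsFlatChart (h : (x : M) → LinearMap.BilinForm ℂ (Tan n x))
    (χ : OpenPartialHomeomorph M (Model n)) : Prop :=
  IsHolChart χ ∧ ∃ A : Matrix (Fin n) (Fin n) ℂ, ∀ y ∈ χ.target, ∀ α β, gram h χ α β y = A α β

end Components

/-- A Frobenius structure of charge `d` on a complex manifold `M` of dimension `n`. -/
structure FrobeniusManifold (n : ℕ) (M : Type*) [TopologicalSpace M] [ChartedSpace (Model n) M]
    (d : ℂ) where
  /-- multiplication of tangent vectors -/
  mul : (x : M) → Tan n x →ₗ[ℂ] Tan n x →ₗ[ℂ] Tan n x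
  /-- the metric `< , >` -/
  metric : (x : M) → LinearMap.BilinForm ℂ (Tan n x)
  /-- the unity vector field `e` -/
  unity : (x : M) → Tan n x
  /-- the Euler vector field `E` -/
  euler : (x : M) → Tan n x
  -- every tangent space is a Frobenius algebra
  mul_comm' : ∀ x u v, mul x u v = mul x v u
  mul_assoc' : ∀ x u v w, mul x (mul x u v) w = mul x u (mul x v w)
  unity_mul : ∀ x u, mul x (unity x) u = u
  metric_symm : ∀ x u v, metric x u v = metric x v u
  metric_nondegenerate : ∀ x, (metric x).Nondegenerate
  metric_invariant : ∀ x u v w, metric x (mul x u v) w = metric x u (mul x v w)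
  -- which depends analytically on the point
  mul_analytic : ∀ χ : OpenPartialHomeomorph M (Model n), IsHolChart χ →
    ∀ α β γ, AnalyticOnNhd ℂ (structConst mul χ α β γ) χ.target
  metric_analytic : ∀ χ : OpenPartialHomeomorph M (Model n), IsHolChart χ →
    ∀ α β, AnalyticOnNhd ℂ (gram metric χ α β) χ.target
  unity_analytic : ∀ χ : OpenPartialHomeomorph M (Model n), IsHolChart χ →
    ∀ α, AnalyticOnNhd ℂ (vecComp unity χ α) χ.target
  euler_analytic : ∀ χ : OpenPartialHomeomorph M (Model n), IsHolChart χ →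
    ∀ α, AnalyticOnNhd ℂ (vecComp euler χ α) χ.target
  /-- the metric is flat -/
  flat : ∀ x : M, ∃ χ : OpenPartialHomeomorph M (Model n), x ∈ χ.source ∧ IsFlatChart metric χ
  /-- `∇ e = 0` -/
  unity_flat : ∀ χ : OpenPartialHomeomorph M (Model n), IsFlatChart metric χ →
    ∀ y ∈ χ.target, ∀ α β, pd α (vecComp unity χ β) y = 0
  /-- `(∇_w c)(u, v, s)` is symmetric in its four arguments (the tensor `c` itself is symmetric) -/
  potentiality : ∀ χ : OpenPartialHomeomorph M (Model n), IsFlatChart metric χ →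
    ∀ y ∈ χ.target, ∀ α β γ δ,
      pd δ (lowerConst metric mul χ α β γ) y = pd α (lowerConst metric mul χ δ β γ) y
  /-- `∇∇E = 0` -/
  euler_linear : ∀ χ : OpenPartialHomeomorph M (Model n), IsFlatChart metric χ →
    ∀ y ∈ χ.target, ∀ α β γ, pd α (pd β (vecComp euler χ γ)) y = 0
  /-- `[E, u · v] - [E, u] · v - u · [E, v] = u · v`, written for `u = ∂_α`, `v = ∂_β`
  (recall `[E, ∂_α] = - (∂_α E^ε) ∂_ε`) -/
  euler_mul : ∀ χ : OpenPartialHomeomorph M (Model n), IsHolChart χ →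
    ∀ y ∈ χ.target, ∀ α β γ,
      ∑ ε, (vecComp euler χ ε y * pd ε (structConst mul χ α β γ) y
          - structConst mul χ α β ε y * pd ε (vecComp euler χ γ) y
          + pd α (vecComp euler χ ε) y * structConst mul χ ε β γ y
          + pd β (vecComp euler χ ε) y * structConst mul χ α ε γ y)
        = structConst mul χ α β γ y
  /-- `E<u, v> - <[E, u], v> - <u, [E, v]> = (2 - d) <u, v>`, written for `u = ∂_α`, `v = ∂_β` -/
  euler_metric : ∀ χ : OpenPartialHomeomorph M (Model n), IsHolChart χ →
    ∀ y ∈ χ.target, ∀ α β,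
      ∑ ε, (vecComp euler χ ε y * pd ε (gram metric χ α β) y
          + pd α (vecComp euler χ ε) y * gram metric χ ε β y
          + pd β (vecComp euler χ ε) y * gram metric χ α ε y)
        = (2 - d) * gram metric χ α β y

namespace FrobeniusManifold

variable {n : ℕ} {M : Type*} [TopologicalSpace M] [ChartedSpace (Model n) M] {d : ℂ}

/-- The isomorphism `T*M → TM` given by the metric `< , >`. -/
def sharp (F : FrobeniusManifold n M d) (x : M) : Module.Dual ℂ (Tan n x) ≃ₗ[ℂ] Tan n x :=
  ((F.metric x).toDual (F.metric_nondegenerate x)).symm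

/-- The intersection form on the cotangent bundle, `(ω₁, ω₂) = i_E (ω₁ · ω₂)`, where 1-forms are
multiplied by means of the isomorphism `T*M ≃ TM` given by `< , >`. -/
def intForm (F : FrobeniusManifold n M d) (x : M) (w₁ w₂ : Module.Dual ℂ (Tan n x)) : ℂ :=
  ((F.sharp x).symm (F.mul x (F.sharp x w₁) (F.sharp x w₂))) (F.euler x)

/-- The contravariant Gram matrix `g^{αβ}(y) = (d y^α, d y^β)` of the intersection form. -/
def coGram (F : FrobeniusManifold n M d) (χ : OpenPartialHomeomorph M (Model n)) (y : Model n) :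
    Matrix (Fin n) (Fin n) ℂ :=
  Matrix.of fun α β =>
    F.intForm (χ.symm y) (coordDiff χ (χ.symm y) α) (coordDiff χ (χ.symm y) β)

/-- The discriminant: the set of points where the intersection form on the cotangent space is
degenerate. -/
def discriminant (F : FrobeniusManifold n M d) : Set M :=
  {x | ∃ w : Module.Dual ℂ (Tan n x), w ≠ 0 ∧ ∀ w', F.intForm x w w' = 0}

/-- The Gram matrix `g_{αβ}(y) = (∂_α, ∂_β)` of the intersection form on the tangent bundle of the
complement of the discriminant: the inverse of the contravariant Gram matrix. -/
def intGram (F : FrobeniusManifold n M d) (χ : OpenPartialHomeomorph M (Model n)) (y : Model n) :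
    Matrix (Fin n) (Fin n) ℂ :=
  (F.coGram χ y)⁻¹

/-- The Christoffel symbols `Γ_{αβ}^γ(y)` of the Levi-Civita connection `∇_*` of the intersection
form. -/
def christoffel (F : FrobeniusManifold n M d) (χ : OpenPartialHomeomorph M (Model n))
    (α β γ : Fin n) (y : Model n) : ℂ :=
  (1 / 2 : ℂ) * ∑ δ, F.coGram χ y γ δ *
    (pd α (fun y' => F.intGram χ y' δ β) y + pd β (fun y' => F.intGram χ y' α δ) y
      - pd δ (fun y' => F.intGram χ y' α β) y)

/-- The dual multiplication `u * v = (u · v) / E`, defined where the multiplication by `E` is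
invertible (on the complement of the discriminant). -/
def dualMul (F : FrobeniusManifold n M d) (x : M) : Tan n x →ₗ[ℂ] Tan n x →ₗ[ℂ] Tan n x :=
  (F.mul x).compr₂ (Ring.inverse (F.mul x (F.euler x) : Module.End ℂ (Tan n x)))

/-- `p` is a twisted period with parameter `ν` on the open set `W`: it is a holomorphic function
with `∇_* dp (u, v) = ν dp (u * v)`, that is, a flat function of the deformed connection of the dual
almost Frobenius manifold. -/
def IsTwistedPeriodOn (F : FrobeniusManifold n M d) (ν : ℂ) (p : M → ℂ) (W : Set M) : Prop :=
  IsOpen W ∧ W ⊆ F.discriminantᶜ ∧ ContMDiffOn 𝓘(ℂ, Model n) 𝓘(ℂ, ℂ) ω p W ∧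
  ∀ χ : OpenPartialHomeomorph M (Model n), IsHolChart χ →
    ∀ y ∈ χ.target, χ.symm y ∈ W → ∀ α β,
      pd α (pd β (p ∘ χ.symm)) y - ∑ γ, F.christoffel χ α β γ y * pd γ (p ∘ χ.symm) y
        = ν * ∑ γ, structConst F.dualMul χ α β γ y * pd γ (p ∘ χ.symm) y

/-- The derivative `Lie_E p` of a function along the Euler vector field. -/
def lieE (F : FrobeniusManifold n M d) (p : M → ℂ) (x : M) : ℂ :=
  (mfderiv 𝓘(ℂ, Model n) 𝓘(ℂ, ℂ) p x : Tan n x →L[ℂ] ℂ) (F.euler x)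

/-- Flat coordinates `t^1, …, t^n` of the metric `< , >` with `e = ∂ / ∂ t^1` (the index `1` of the
usual numbering is `0 : Fin n`). -/
def IsUnitalFlatChart [NeZero n] (F : FrobeniusManifold n M d)
    (φ : OpenPartialHomeomorph M (Model n)) : Prop :=
  IsFlatChart F.metric φ ∧ ∀ y ∈ φ.target, F.unity (φ.symm y) = coordVec φ y 0

/-- The function `t_1 = η_{1α} t^α` on the domain of the flat coordinates `φ = (t^1, …, t^n)`. -/
def lowerT [NeZero n] (F : FrobeniusManifold n M d) (φ : OpenPartialHomeomorph M (Model n))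
    (x : M) : ℂ :=
  ∑ α, gram F.metric φ 0 α (φ x) * φ x α

end FrobeniusManifold

/-- `f` is homogeneous of the complex degree `k` on `W ⊆ ℂⁿ`: `f(c y) = c^k f(y)`, where
`c = exp τ`, `c^k = exp (k τ)`, whenever the path `exp (s τ) y`, `0 ≤ s ≤ 1`, stays in `W`. -/
def IsHomogeneousOn {n : ℕ} (f : Model n → ℂ) (W : Set (Model n)) (k : ℂ) : Prop :=
  ∀ y ∈ W, ∀ τ : ℂ, (∀ s ∈ Set.Icc (0 : ℝ) 1, Complex.exp (s * τ) • y ∈ W) →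
    f (Complex.exp τ • y) = Complex.exp (k * τ) * f y

end

end FrobeniusGeometry

/-! Off the discriminant the intersection form on tangent vectors is `(u, v) = ⟨u * v, e⟩`. Since `u
* E = u`, this gives `(u, E) = ⟨u, e⟩ = dt_1(u)`: lowering `E` with the intersection form yields the
closed form `dt_1`. The form `⟨u · v, E⟩` has weight `1 + (2 - d) = 3 - d` under `Lie_E`. Raising
both indices with `⟨ , ⟩` subtracts `2 (2 - d)` and inverting flips the sign, so `Lie_E ( , ) = (1 -
d) ( , )` (`lie_intGram`). A field that scales a metric by a constant `k` and whose lowered form is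
closed has covariant derivative `k / 2`. Hence `∇_* E = (1 - d) / 2` and `∇_* dt_1 = (1 - d) / 2 ( ,
)` (`sum_christoffel_mul_euler_flat`, `sum_christoffel_mul_metric`).

Put `κ = ((1 - d) / 2 - ν)⁻¹` and apply `∇_*` to `κ dt_1 = ∑ f_i dz^i`. The right side becomes the
Hessian of `f` plus `∑ f_i ∇_* dz^i`; by the twisted period equation the latter is `ν κ dt_1(u * v)
= ν κ (u, v)`. So the Hessian is `κ ((1 - d) / 2 - ν) ( , ) = ( , )`. This is computed in the flat
chart, where `dt_1` has constant components (`sum_hessian_eq_intGram`), then carried to the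
coordinates `z` (`intGram_eq_hessian`).

For a twisted period, `d(Lie_E p) = (∇_* dp)(·, E) + dp(∇_* E) = (ν + (1 - d) / 2) dp`
(`pd_lie_twisted`); for `t_1` the factor is `1 - d` (`pd_lie_lowerT`). On a connected domain the
integration constants are absorbed into the functions (`exists_lieE_add_const`). After normalization
`E` is a multiple of `∑ z^i ∂_i`, so quasihomogeneity of `t_1` is Euler's identity for `f`, which
integrates along `exp (s τ) z` (`isHomogeneousOn_of_euler`). -/

namespace FrobeniusGeometry

/-! ### Calculus of the coordinate derivatives `pd`. -/

section PartialDerivatives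

variable {n : ℕ} {α : Fin n} {f g : Model n → ℂ} {y : Model n}

theorem pd_congr (h : f =ᶠ[nhds y] g) : pd α f y = pd α g y := by
  simp only [pd, h.fderiv_eq]

theorem pd_const (c : ℂ) : pd α (fun _ => c) y = 0 := by
  simp [pd]

theorem pd_mul (hf : DifferentiableAt ℂ f y) (hg : DifferentiableAt ℂ g y) :
    pd α (fun x => f x * g x) y = pd α f y * g y + f y * pd α g y := by
  simp only [pd, fderiv_fun_mul hf hg]
  simp
  ring

theorem pd_const_mul (c : ℂ) (hf : DifferentiableAt ℂ f y) :
    pd α (fun x => c * f x) y = c * pd α f y := by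
  rw [pd_mul (differentiableAt_const c) hf, pd_const]
  ring

theorem pd_mul_const (c : ℂ) (hf : DifferentiableAt ℂ f y) :
    pd α (fun x => f x * c) y = pd α f y * c := by
  rw [pd_mul hf (differentiableAt_const c), pd_const]
  ring

theorem pd_sub (hf : DifferentiableAt ℂ f y) (hg : DifferentiableAt ℂ g y) :
    pd α (fun x => f x - g x) y = pd α f y - pd α g y := by
  simp [pd, fderiv_fun_sub hf hg]

theorem pd_sum {ι : Type*} (s : Finset ι) {F : ι → Model n → ℂ}
    (h : ∀ i ∈ s, DifferentiableAt ℂ (F i) y) :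
    pd α (fun x => ∑ i ∈ s, F i x) y = ∑ i ∈ s, pd α (F i) y := by
  simp [pd, fderiv_fun_sum h]

theorem pd_apply (β : Fin n) : pd α (fun x => x β) y = if β = α then 1 else 0 := by
  have : fderiv ℂ (fun x : Model n => x β) y = ContinuousLinearMap.proj β :=
    (ContinuousLinearMap.proj (R := ℂ) (φ := fun _ : Fin n => ℂ) β).fderiv
  simp [pd, this, Pi.single_apply]

theorem fderiv_apply_eq_sum (v : Model n) : fderiv ℂ f y v = ∑ α, v α * pd α f y := by
  conv_lhs => rw [pi_eq_sum_univ' v]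
  simp only [map_sum, map_smul, smul_eq_mul, pd]

theorem fderiv_eq_zero_of_pd (h : ∀ α, pd α f y = 0) : fderiv ℂ f y = 0 := by
  ext v
  simp [fderiv_apply_eq_sum, h]

theorem pd_comp {Z : Model n → Model n} (hf : DifferentiableAt ℂ f (Z y))
    (hZ : DifferentiableAt ℂ Z y) :
    pd α (fun x => f (Z x)) y = ∑ i, pd α (fun x => Z x i) y * pd i f (Z y) := by
  have : fderiv ℂ (fun x => f (Z x)) y = (fderiv ℂ f (Z y)).comp (fderiv ℂ Z y) :=
    fderiv_comp y hf hZ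
  rw [pd, this, ContinuousLinearMap.comp_apply, fderiv_apply_eq_sum]
  refine Finset.sum_congr rfl fun i _ => ?_
  simp only [pd]
  rw [fderiv_apply hZ]
  rfl

theorem analyticAt_pd (hf : AnalyticAt ℂ f y) : AnalyticAt ℂ (pd α f) y :=
  ((ContinuousLinearMap.apply ℂ ℂ (Pi.single α (1 : ℂ) : Model n)).analyticAt _).comp hf.fderiv

end PartialDerivatives

/-! ### Coordinate frames, coframes and changes of holomorphic charts. -/

section Charts

variable {n : ℕ} {M : Type*} [TopologicalSpace M] [ChartedSpace (Model n) M]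
  {χ φ ψ : OpenPartialHomeomorph M (Model n)}

theorem IsHolChart.mdifferentiable (h : IsHolChart χ) :
    χ.MDifferentiable 𝓘(ℂ, Model n) 𝓘(ℂ, Model n) :=
  ⟨(contMDiffOn_of_mem_maximalAtlas h).mdifferentiableOn (by simp),
    (contMDiffOn_symm_of_mem_maximalAtlas h).mdifferentiableOn (by simp)⟩

theorem IsHolChart.mdifferentiableAt (h : IsHolChart χ) {x : M} (hx : x ∈ χ.source) :
    MDifferentiableAt 𝓘(ℂ, Model n) 𝓘(ℂ, Model n) χ x :=
  h.mdifferentiable.mdifferentiableAt hx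

theorem IsHolChart.mdifferentiableAt_symm (h : IsHolChart χ) {y : Model n} (hy : y ∈ χ.target) :
    MDifferentiableAt 𝓘(ℂ, Model n) 𝓘(ℂ, Model n) χ.symm y :=
  h.mdifferentiable.mdifferentiableAt_symm hy

theorem coordDiff_coordVec (h : IsHolChart χ) {y : Model n} (hy : y ∈ χ.target) (α β : Fin n) :
    coordDiff χ (χ.symm y) α (coordVec χ y β) = if α = β then 1 else 0 := by
  have := DFunLike.congr_fun (h.mdifferentiable.comp_symm_deriv hy)
    (Pi.single β (1 : ℂ) : Fin n → ℂ)
  have h2 := congrFun this α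
  refine h2.trans ?_
  change (Pi.single β (1 : ℂ) : Fin n → ℂ) α = _
  simp [Pi.single_apply]

theorem sum_coordDiff_smul_coordVec (h : IsHolChart χ) {y : Model n} (hy : y ∈ χ.target)
    (v : Tan n (χ.symm y)) : ∑ α, coordDiff χ (χ.symm y) α v • coordVec χ y α = v := by
  have hs := χ.map_target hy
  have := DFunLike.congr_fun (h.mdifferentiable.symm_comp_deriv hs) v
  rw [χ.right_inv hy] at this
  refine Eq.trans ?_ this
  have hv : mfderiv 𝓘(ℂ, Model n) 𝓘(ℂ, Model n) χ (χ.symm y) v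
      = ∑ α, coordDiff χ (χ.symm y) α v • (Pi.single α (1 : ℂ) : Fin n → ℂ) :=
    pi_eq_sum_univ' (R := ℂ) (ι := Fin n) _
  -- The tangent spaces of the model are `Fin n → ℂ` only after unfolding; quantifying over a plain
  -- vector `w` lets the basis expansion `hv` be substituted.
  have e : ∀ w : Fin n → ℂ, w = mfderiv 𝓘(ℂ, Model n) 𝓘(ℂ, Model n) χ (χ.symm y) v →
    mfderiv 𝓘(ℂ, Model n) 𝓘(ℂ, Model n) χ.symm y w
    = mfderiv 𝓘(ℂ, Model n) 𝓘(ℂ, Model n) χ.symm y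
      (mfderiv 𝓘(ℂ, Model n) 𝓘(ℂ, Model n) χ (χ.symm y) v) := fun w hw => by rw [hw]
  refine Eq.trans ?_ (e _ hv.symm)
  refine Eq.trans ?_ (map_sum (mfderiv 𝓘(ℂ, Model n) 𝓘(ℂ, Model n) χ.symm y) _ _).symm
  refine Finset.sum_congr rfl fun i _ => ?_
  exact (map_smul (mfderiv 𝓘(ℂ, Model n) 𝓘(ℂ, Model n) χ.symm y) _ _).symm

theorem dual_apply_eq_sum (h : IsHolChart χ) {y : Model n} (hy : y ∈ χ.target)
    {V : Type*} [AddCommMonoid V] [Module ℂ V]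
    (l : Tan n (χ.symm y) →ₗ[ℂ] V) (v : Tan n (χ.symm y)) :
    l v = ∑ α, coordDiff χ (χ.symm y) α v • l (coordVec χ y α) := by
  conv_lhs => rw [← sum_coordDiff_smul_coordVec h hy v]
  simp only [map_sum, map_smul]

theorem mfderiv_coordVec (h : IsHolChart χ) {y : Model n} (hy : y ∈ χ.target) {p : M → ℂ}
    (hp : MDifferentiableAt 𝓘(ℂ, Model n) 𝓘(ℂ, ℂ) p (χ.symm y)) (α : Fin n) :
    (mfderiv 𝓘(ℂ, Model n) 𝓘(ℂ, ℂ) p (χ.symm y) : Tan n (χ.symm y) →L[ℂ] ℂ) (coordVec χ y α)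
      = pd α (p ∘ χ.symm) y := by
  have := mfderiv_comp y hp (h.mdifferentiableAt_symm hy)
  rw [mfderiv_eq_fderiv] at this
  exact (DFunLike.congr_fun this (Pi.single α (1 : ℂ) : Fin n → ℂ)).symm

theorem mfderiv_apply_eq_sum (h : IsHolChart χ) {y : Model n} (hy : y ∈ χ.target) {p : M → ℂ}
    (hp : MDifferentiableAt 𝓘(ℂ, Model n) 𝓘(ℂ, ℂ) p (χ.symm y)) (v : Tan n (χ.symm y)) :
    (mfderiv 𝓘(ℂ, Model n) 𝓘(ℂ, ℂ) p (χ.symm y) : Tan n (χ.symm y) →L[ℂ] ℂ) v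
      = ∑ α, coordDiff χ (χ.symm y) α v * pd α (p ∘ χ.symm) y := by
  refine (dual_apply_eq_sum h hy
    (mfderiv 𝓘(ℂ, Model n) 𝓘(ℂ, ℂ) p (χ.symm y) : Tan n (χ.symm y) →L[ℂ] ℂ).toLinearMap v).trans ?_
  refine Finset.sum_congr rfl fun i _ => ?_
  rw [← mfderiv_coordVec h hy hp]
  rfl

theorem IsHolChart.mdifferentiableAt_apply (h : IsHolChart ψ) {x : M} (hx : x ∈ ψ.source)
    (i : Fin n) : MDifferentiableAt 𝓘(ℂ, Model n) 𝓘(ℂ, ℂ) (fun x' => ψ x' i) x :=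
  ((ContinuousLinearMap.proj (R := ℂ) (φ := fun _ : Fin n => ℂ) i).differentiableAt
    |>.mdifferentiableAt).comp x (h.mdifferentiableAt hx)

theorem coordDiff_eq_mfderiv (h : IsHolChart ψ) {x : M} (hx : x ∈ ψ.source) (i : Fin n)
    (v : Tan n x) : coordDiff ψ x i v
      = (mfderiv 𝓘(ℂ, Model n) 𝓘(ℂ, ℂ) (fun x' => ψ x' i) x : Tan n x →L[ℂ] ℂ) v := by
  have h1 : MDifferentiableAt 𝓘(ℂ, Model n) 𝓘(ℂ, ℂ) (fun z : Model n => z i) (ψ x) :=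
    (ContinuousLinearMap.proj (R := ℂ) (φ := fun _ : Fin n => ℂ) i).differentiableAt
      |>.mdifferentiableAt
  have := mfderiv_comp x h1 (h.mdifferentiableAt hx)
  rw [mfderiv_eq_fderiv] at this
  have h2 : fderiv ℂ (fun z : Model n => z i) (ψ x) = ContinuousLinearMap.proj i :=
    (ContinuousLinearMap.proj (R := ℂ) (φ := fun _ : Fin n => ℂ) i).fderiv
  rw [h2] at this
  exact (DFunLike.congr_fun this v).symm

theorem coordDiff_coordVec_eq_pd (hφ : IsHolChart φ) (hψ : IsHolChart ψ) {y : Model n}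
    (hy : y ∈ φ.target) (hy' : φ.symm y ∈ ψ.source) (i α : Fin n) :
    coordDiff ψ (φ.symm y) i (coordVec φ y α) = pd α (fun t => ψ (φ.symm t) i) y := by
  rw [coordDiff_eq_mfderiv hψ hy', mfderiv_coordVec hφ hy (hψ.mdifferentiableAt_apply hy' i)]
  rfl

/-- The base point `x` is kept separate from `ψ.symm y`, so that points presented through another
chart need no transport of tangent vectors. -/
theorem gram_eq_sum (hψ : IsHolChart ψ) (h : (x : M) → LinearMap.BilinForm ℂ (Tan n x))
    {y : Model n} {x : M} (hy : y ∈ ψ.target) (hx : ψ.symm y = x) (u v : Tan n x) :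
    h x u v = ∑ i, ∑ j, coordDiff ψ x i u * coordDiff ψ x j v * gram h ψ i j y := by
  subst hx
  rw [dual_apply_eq_sum hψ hy (h _) u]
  simp only [LinearMap.sum_apply, LinearMap.smul_apply]
  refine Finset.sum_congr rfl fun i _ => ?_
  rw [dual_apply_eq_sum hψ hy (h _ _) v, Finset.smul_sum]
  refine Finset.sum_congr rfl fun j _ => ?_
  simp only [smul_eq_mul, gram]
  ring

theorem gram_change (hφ : IsHolChart φ) (hψ : IsHolChart ψ)
    (h : (x : M) → LinearMap.BilinForm ℂ (Tan n x)) {y : Model n}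
    (hy : y ∈ φ.target) (hy' : φ.symm y ∈ ψ.source) (α β : Fin n) :
    gram h φ α β y = ∑ i, ∑ j, pd α (fun t => ψ (φ.symm t) i) y
      * pd β (fun t => ψ (φ.symm t) j) y * gram h ψ i j (ψ (φ.symm y)) := by
  rw [gram, gram_eq_sum hψ h (ψ.map_source hy') (ψ.left_inv hy')]
  simp only [coordDiff_coordVec_eq_pd hφ hψ hy hy']

theorem analyticAt_transition [IsManifold 𝓘(ℂ, Model n) ω M] (hφ : IsHolChart φ)
    (hψ : IsHolChart ψ) {y : Model n}
    (hy : y ∈ φ.target) (hy' : φ.symm y ∈ ψ.source) :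
    AnalyticAt ℂ (fun t => ψ (φ.symm t)) y := by
  have h1 : ContMDiffOn 𝓘(ℂ, Model n) 𝓘(ℂ, Model n) ω (ψ ∘ φ.symm) (φ.symm ≫ₕ ψ).source := by
    refine (contMDiffOn_of_mem_maximalAtlas hψ).comp
      ((contMDiffOn_symm_of_mem_maximalAtlas hφ).mono ?_) ?_
    · intro t ht
      simp only [OpenPartialHomeomorph.trans_source, OpenPartialHomeomorph.symm_source] at ht
      exact ht.1
    · intro t ht
      simp only [OpenPartialHomeomorph.trans_source, OpenPartialHomeomorph.symm_source] at ht
      exact ht.2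
  have h2 := (contMDiffOn_iff_contDiffOn.1 h1).analyticOn
  rw [(φ.symm ≫ₕ ψ).open_source.analyticOn_iff_analyticOnNhd] at h2
  refine h2 y ?_
  simp only [OpenPartialHomeomorph.trans_source, OpenPartialHomeomorph.symm_source]
  exact ⟨hy, hy'⟩

end Charts

end FrobeniusGeometry

namespace FrobeniusGeometry

namespace FrobeniusManifold

/-! ### Pointwise algebra: the dual product and the intersection form. -/

section Algebra

variable {n : ℕ} {M : Type*} [TopologicalSpace M] [ChartedSpace (Model n) M] {d : ℂ}
  (F : FrobeniusManifold n M d) {x : M}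

theorem metric_sharp (x : M) (w : Module.Dual ℂ (Tan n x)) (v : Tan n x) :
    F.metric x (F.sharp x w) v = w v := by
  have := (F.metric x).apply_toDual_symm_apply (hB := F.metric_nondegenerate x) w v
  exact this

theorem sharp_metric (x : M) (u : Tan n x) : F.sharp x (F.metric x u) = u := by
  rw [sharp, LinearEquiv.symm_apply_eq]
  rfl

theorem intForm_eq (x : M) (w₁ w₂ : Module.Dual ℂ (Tan n x)) :
    F.intForm x w₁ w₂ = F.metric x (F.mul x (F.sharp x w₁) (F.sharp x w₂)) (F.euler x) := rfl

/-- If `E · u = 0`, invariance makes the covector `⟨u, ·⟩` orthogonal to everything for the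
intersection form, so `u = 0` off the discriminant. In finite dimension injectivity suffices, and
`Ring.inverse` in `dualMul` is then a true inverse. -/
theorem isUnit_mul_euler (hx : x ∉ F.discriminant) :
    IsUnit (F.mul x (F.euler x) : Module.End ℂ (Tan n x)) := by
  rw [LinearMap.isUnit_iff_ker_eq_bot, LinearMap.ker_eq_bot']
  intro u hu
  by_contra hne
  refine hx ⟨F.metric x u, fun h0 => hne ?_, fun w' => ?_⟩
  · rw [← F.sharp_metric x u, h0, map_zero]
  · rw [intForm_eq, sharp_metric, F.metric_symm, ← F.metric_invariant, hu]
    simp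

theorem mul_euler_dualMul (hx : x ∉ F.discriminant) (u v : Tan n x) :
    F.mul x (F.euler x) (F.dualMul x u v) = F.mul x u v := by
  have := DFunLike.congr_fun (Ring.mul_inverse_cancel _ (F.isUnit_mul_euler hx)) (F.mul x u v)
  exact this

theorem mul_euler_injective (hx : x ∉ F.discriminant) :
    Function.Injective (F.mul x (F.euler x)) := by
  rw [← LinearMap.ker_eq_bot]
  exact (LinearMap.isUnit_iff_ker_eq_bot _).1 (F.isUnit_mul_euler hx)

theorem dualMul_comm (u v : Tan n x) : F.dualMul x u v = F.dualMul x v u := by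
  simp only [dualMul, LinearMap.compr₂_apply, F.mul_comm' x u v]

theorem dualMul_euler (hx : x ∉ F.discriminant) (u : Tan n x) :
    F.dualMul x u (F.euler x) = u :=
  F.mul_euler_injective hx (by rw [mul_euler_dualMul F hx, F.mul_comm'])

theorem mul_unity (u : Tan n x) : F.mul x u (F.unity x) = u := by
  rw [F.mul_comm', F.unity_mul]

/-- The intersection form on the tangent bundle of the complement of the discriminant. -/
noncomputable def tanForm (x : M) : LinearMap.BilinForm ℂ (Tan n x) :=
  (F.dualMul x).compr₂ ((F.metric x).flip (F.unity x))

theorem tanForm_apply (u v : Tan n x) :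
    F.tanForm x u v = F.metric x (F.dualMul x u v) (F.unity x) := rfl

theorem tanForm_euler (hx : x ∉ F.discriminant) (u : Tan n x) :
    F.tanForm x u (F.euler x) = F.metric x u (F.unity x) := by
  rw [tanForm_apply, dualMul_euler F hx]

theorem tanForm_symm (u v : Tan n x) : F.tanForm x u v = F.tanForm x v u := by
  rw [tanForm_apply, tanForm_apply, dualMul_comm]

/-- Because `u * v = (v * e) · u`, lowering `v` with the intersection form equals lowering `v * e =
E⁻¹ · v` with `⟨ , ⟩`. -/
theorem tanForm_eq_metric (hx : x ∉ F.discriminant) (u v : Tan n x) :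
    F.tanForm x u v = F.metric x (F.dualMul x v (F.unity x)) u := by
  have : F.dualMul x u v = F.mul x (F.dualMul x v (F.unity x)) u := by
    refine F.mul_euler_injective hx ?_
    rw [mul_euler_dualMul F hx, ← F.mul_assoc', mul_euler_dualMul F hx, mul_unity, F.mul_comm']
  rw [tanForm_apply, this, F.metric_invariant, mul_unity]

/-- The form `w₂ = (v, ·)` satisfies `(w, w₂) = w(v)`. -/
theorem intForm_tanForm (hx : x ∉ F.discriminant) (w : Module.Dual ℂ (Tan n x)) (v : Tan n x) :
    F.intForm x w (F.tanForm x v) = w v := by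
  have : F.tanForm x v = F.metric x (F.dualMul x v (F.unity x)) := by
    ext u
    rw [tanForm_symm, tanForm_eq_metric F hx]
  rw [this, intForm_eq, sharp_metric, F.metric_invariant, F.mul_comm' x _ (F.euler x),
    mul_euler_dualMul F hx, mul_unity, metric_sharp]

theorem gram_tanForm_symm (χ : OpenPartialHomeomorph M (Model n)) (y : Model n) (α β : Fin n) :
    gram F.tanForm χ α β y = gram F.tanForm χ β α y := F.tanForm_symm _ _

theorem dual_eq_sum {χ : OpenPartialHomeomorph M (Model n)}
    (h : IsHolChart χ) {y : Model n} (hy : y ∈ χ.target) (w : Module.Dual ℂ (Tan n (χ.symm y))) :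
    w = ∑ β, w (coordVec χ y β) • coordDiff χ (χ.symm y) β := by
  ext v
  rw [dual_apply_eq_sum h hy w v]
  simp only [LinearMap.sum_apply, LinearMap.smul_apply, smul_eq_mul]
  exact Finset.sum_congr rfl fun _ _ => mul_comm _ _

theorem intForm_sum_right (x : M) (w : Module.Dual ℂ (Tan n x)) (c : Fin n → ℂ)
    (w' : Fin n → Module.Dual ℂ (Tan n x)) :
    F.intForm x w (∑ β, c β • w' β) = ∑ β, c β * F.intForm x w (w' β) := by
  simp only [intForm_eq, map_sum, map_smul, LinearMap.sum_apply, LinearMap.smul_apply, smul_eq_mul]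

theorem intForm_comm (x : M) (w w' : Module.Dual ℂ (Tan n x)) :
    F.intForm x w w' = F.intForm x w' w := by
  rw [intForm_eq, intForm_eq, F.mul_comm']

variable {χ : OpenPartialHomeomorph M (Model n)} {y : Model n}

/-- Identifies the matrix inverse that defines `intGram` with the components of the tensor
`tanForm`, so that tensor arguments apply to it. -/
theorem coGram_mul_gram (h : IsHolChart χ) (hy : y ∈ χ.target)
    (hd : χ.symm y ∉ F.discriminant) :
    F.coGram χ y * Matrix.of (fun α β => gram F.tanForm χ α β y) = 1 := by
  ext α γ
  have h1 := F.intForm_tanForm hd (coordDiff χ (χ.symm y) α) (coordVec χ y γ)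
  rw [dual_eq_sum h hy (F.tanForm _ (coordVec χ y γ)), intForm_sum_right,
    coordDiff_coordVec h hy] at h1
  rw [Matrix.mul_apply, Matrix.one_apply, ← h1]
  refine Finset.sum_congr rfl fun β _ => ?_
  rw [Matrix.of_apply, gram_tanForm_symm, mul_comm]
  rfl

theorem intGram_eq (h : IsHolChart χ) (hy : y ∈ χ.target) (hd : χ.symm y ∉ F.discriminant)
    (α β : Fin n) : F.intGram χ y α β = gram F.tanForm χ α β y := by
  rw [intGram, Matrix.inv_eq_right_inv (F.coGram_mul_gram h hy hd), Matrix.of_apply]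

theorem intGram_mul_coGram (h : IsHolChart χ) (hy : y ∈ χ.target)
    (hd : χ.symm y ∉ F.discriminant) : F.intGram χ y * F.coGram χ y = 1 := by
  rw [intGram, Matrix.inv_eq_right_inv (F.coGram_mul_gram h hy hd)]
  exact mul_eq_one_comm.1 (F.coGram_mul_gram h hy hd)

/-- `g_{αβ} E^β = ⟨∂_α, e⟩`. -/
theorem sum_intGram_mul_euler (h : IsHolChart χ) (hy : y ∈ χ.target)
    (hd : χ.symm y ∉ F.discriminant) (α : Fin n) :
    ∑ β, F.intGram χ y α β * vecComp F.euler χ β y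
      = F.metric _ (coordVec χ y α) (F.unity (χ.symm y)) := by
  rw [← F.tanForm_euler hd, dual_apply_eq_sum h hy (F.tanForm _ (coordVec χ y α))]
  refine Finset.sum_congr rfl fun β _ => ?_
  rw [F.intGram_eq h hy hd, smul_eq_mul, mul_comm]
  rfl

/-- `C_{αβ}^γ E^β = δ_α^γ` for the structure constants `C` of the dual multiplication. -/
theorem sum_structConst_dualMul_mul_euler (h : IsHolChart χ) (hy : y ∈ χ.target)
    (hd : χ.symm y ∉ F.discriminant) (α γ : Fin n) :
    ∑ β, structConst F.dualMul χ α β γ y * vecComp F.euler χ β y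
      = if γ = α then 1 else 0 := by
  rw [← coordDiff_coordVec h hy, ← F.dualMul_euler hd (coordVec χ y α),
    ← LinearMap.comp_apply (coordDiff χ (χ.symm y) γ),
    dual_apply_eq_sum h hy (coordDiff χ (χ.symm y) γ ∘ₗ F.dualMul _ (coordVec χ y α))]
  refine Finset.sum_congr rfl fun β _ => ?_
  rw [smul_eq_mul, mul_comm]
  rfl

/-- `C_{αβ}^γ ⟨∂_γ, e⟩ = g_{αβ}` for the structure constants `C` of the dual multiplication. -/
theorem sum_structConst_dualMul_mul_metric (h : IsHolChart χ) (hy : y ∈ χ.target)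
    (hd : χ.symm y ∉ F.discriminant) (α β : Fin n) :
    ∑ γ, structConst F.dualMul χ α β γ y * F.metric _ (coordVec χ y γ) (F.unity (χ.symm y))
      = F.intGram χ y α β := by
  rw [F.intGram_eq h hy hd, gram, tanForm_apply, F.metric_symm,
    dual_apply_eq_sum h hy (F.metric _ (F.unity _))]
  refine Finset.sum_congr rfl fun γ _ => ?_
  rw [smul_eq_mul, F.metric_symm]
  rfl

/-- The matrix `⟨∂_α · ∂_β, E⟩` is `A X A`, where `A` is the Gram matrix of the metric and `X` the
contravariant Gram matrix of the intersection form. -/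
theorem gram_mul_coGram_mul_gram (h : IsHolChart χ) (hy : y ∈ χ.target) (α β : Fin n) :
    (Matrix.of (fun α β => gram F.metric χ α β y) * F.coGram χ y
      * Matrix.of (fun α β => gram F.metric χ α β y)) α β
      = F.metric _ (F.mul _ (coordVec χ y α) (coordVec χ y β)) (F.euler (χ.symm y)) := by
  have h1 := F.intForm_eq (χ.symm y) (F.metric _ (coordVec χ y α)) (F.metric _ (coordVec χ y β))
  rw [F.sharp_metric, F.sharp_metric] at h1
  rw [← h1, dual_eq_sum h hy (F.metric _ (coordVec χ y β)), intForm_sum_right, Matrix.mul_apply]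
  refine Finset.sum_congr rfl fun μ _ => ?_
  rw [Matrix.mul_apply, intForm_comm, dual_eq_sum h hy (F.metric _ (coordVec χ y α)),
    intForm_sum_right, F.metric_symm _ (coordVec χ y β), mul_comm]
  congr 1
  refine Finset.sum_congr rfl fun ν _ => ?_
  rw [intForm_comm]
  rfl

theorem exists_gram_mul_eq_one (h : IsHolChart χ) (hy : y ∈ χ.target) :
    ∃ B : Matrix (Fin n) (Fin n) ℂ, Matrix.of (fun α β => gram F.metric χ α β y) * B = 1 := by
  refine ⟨Matrix.of fun β γ => coordDiff χ (χ.symm y) β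
    (F.sharp _ (coordDiff χ (χ.symm y) γ)), ?_⟩
  ext α γ
  have h1 := F.metric_sharp _ (coordDiff χ (χ.symm y) γ) (coordVec χ y α)
  rw [F.metric_symm, dual_apply_eq_sum h hy (F.metric _ (coordVec χ y α)),
    coordDiff_coordVec h hy] at h1
  rw [Matrix.mul_apply, Matrix.one_apply]
  simp only [eq_comm (a := α), ← h1]
  refine Finset.sum_congr rfl fun β _ => ?_
  rw [smul_eq_mul, mul_comm]
  rfl

end Algebra

end FrobeniusManifold

end FrobeniusGeometry

namespace FrobeniusGeometry

/-! ### Index computations behind `Lie_E ( , )`, `∇_* E` and `∇_* dt_1`. -/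

section MatrixIdentities

variable {n : ℕ}

/-- The derivative of the Gram matrix of the intersection form along the Euler vector field, from
that of the matrix `K = A X A` of the form `⟨u · v, E⟩`. -/
theorem lie_gram_of_lie_cogram {A B X G K Q DK DX DG : Matrix (Fin n) (Fin n) ℂ} {d : ℂ}
    (hAB : A * B = 1) (hGX : G * X = 1) (hK : K = A * X * A)
    (hQ : Q * A + A * Q.transpose = (2 - d) • A)
    (hDK : DK + Q * K + K * Q.transpose = (3 - d) • K) (hDX : DX = B * DK * B)
    (hDG : DG * X + G * DX = 0) :
    DG + Q * G + G * Q.transpose = (1 - d) • G := by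
  have hBA := mul_eq_one_comm.1 hAB
  have hXG := mul_eq_one_comm.1 hGX
  have e1 : DK = (3 - d) • K - Q * K - K * Q.transpose := by rw [← hDK]; abel
  have e2 : Q * A = (2 - d) • A - A * Q.transpose := by rw [← hQ]; abel
  have e3 : A * Q.transpose = (2 - d) • A - Q * A := by rw [← hQ]; abel
  have k1 : B * K * B = X := by
    rw [hK]
    calc B * (A * X * A) * B = (B * A) * X * (A * B) := by noncomm_ring
      _ = X := by rw [hAB, hBA]; simp
  have k2 : B * (Q * K) * B = (2 - d) • X - Q.transpose * X := by
    rw [hK]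
    calc B * (Q * (A * X * A)) * B = B * (Q * A) * X * (A * B) := by noncomm_ring
      _ = (2 - d) • ((B * A) * X) - (B * A) * Q.transpose * X := by
          rw [hAB, e2]
          simp only [mul_sub, sub_mul, mul_one, Matrix.mul_smul, Matrix.smul_mul, mul_assoc]
      _ = _ := by rw [hBA]; simp
  have k3 : B * (K * Q.transpose) * B = (2 - d) • X - X * Q := by
    rw [hK]
    calc B * (A * X * A * Q.transpose) * B = (B * A) * X * (A * Q.transpose) * B := by
          noncomm_ring
      _ = (2 - d) • (X * (A * B)) - X * Q * (A * B) := by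
          rw [hBA, e3]
          simp only [mul_sub, sub_mul, one_mul, Matrix.mul_smul, Matrix.smul_mul, mul_assoc]
      _ = _ := by rw [hAB]; simp
  -- The weight is `(3 - d) - 2 (2 - d) = d - 1`; the terms in `Q` change sign because the indices
  -- of `X` are upper.
  have hX : DX = (d - 1) • X + Q.transpose * X + X * Q := by
    rw [hDX, e1]
    simp only [mul_sub, sub_mul, Matrix.mul_smul, Matrix.smul_mul, k1, k2, k3]
    module
  -- The usual derivative of an inverse matrix, which turns weight `d - 1` into `1 - d`.
  have hG : DG = -(G * DX * G) := by
    have : DG * X * G = -(G * DX * G) := by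
      rw [eq_neg_of_add_eq_zero_left hDG]; noncomm_ring
    rw [← this, mul_assoc, hXG, mul_one]
  have g1 : G * DX * G = (d - 1) • G + G * Q.transpose + Q * G := by
    rw [hX]
    calc G * ((d - 1) • X + Q.transpose * X + X * Q) * G
        = (d - 1) • ((G * X) * G) + G * Q.transpose * (X * G) + (G * X) * Q * G := by
          simp only [mul_add, add_mul, Matrix.mul_smul, Matrix.smul_mul, mul_assoc]
      _ = _ := by rw [hGX, hXG]; simp
  rw [hG, g1]
  module

variable {G X Q : Matrix (Fin n) (Fin n) ℂ} {dG : Fin n → Matrix (Fin n) (Fin n) ℂ}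
  {E a : Fin n → ℂ} {k : ℂ}

/-- Here `dG γ α β` is `∂_γ G_{αβ}` and `Q α ε` is `∂_α E^ε`. Hypothesis `h1` differentiates the
constancy of the lowered field `G_{δε} E^ε`, and `h2` says `Lie_E G = k G`; together they remove
every derivative of `G` from the Koszul expression contracted with `E`. -/
theorem sum_koszul_mul_euler (hsymm : ∀ α β, G α β = G β α)
    (h1 : ∀ β δ, ∑ ε, dG β δ ε * E ε = -∑ ε, G δ ε * Q β ε)
    (h2 : ∀ α β, ∑ ε, (E ε * dG ε α β + Q α ε * G ε β + Q β ε * G α ε) = k * G α β)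
    (β δ : Fin n) :
    ∑ ε, (dG β δ ε + dG ε β δ - dG δ β ε) * E ε = k * G β δ - 2 * ∑ ε, Q β ε * G ε δ := by
  have e1 := h1 β δ
  have e2 := h1 δ β
  have e3 := h2 β δ
  simp only [Finset.sum_add_distrib] at e3
  have e4 : ∑ ε, Q β ε * G ε δ = ∑ ε, G δ ε * Q β ε :=
    Finset.sum_congr rfl fun ε _ => by rw [hsymm δ ε]; ring
  have e5 : ∑ ε, Q δ ε * G β ε = ∑ ε, G β ε * Q δ ε :=
    Finset.sum_congr rfl fun ε _ => by ring
  have e6 : ∑ ε, E ε * dG ε β δ = ∑ ε, dG ε β δ * E ε :=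
    Finset.sum_congr rfl fun ε _ => by ring
  have e7 : ∑ ε, (dG β δ ε + dG ε β δ - dG δ β ε) * E ε
      = ∑ ε, dG β δ ε * E ε + ∑ ε, dG ε β δ * E ε - ∑ ε, dG δ β ε * E ε := by
    simp only [add_mul, sub_mul, Finset.sum_add_distrib, Finset.sum_sub_distrib]
  rw [e7]
  linear_combination e1 - e2 + e3 + e6 * (-1) + e4 - e5

/-- This is `∇E = k / 2`: the antisymmetric part of the lowered `∇E` vanishes because the lowered
field is closed, and the symmetric part is half of `Lie_E G`. -/
theorem sum_christoffel_mul_euler (hGX : G * X = 1) (hsymm : ∀ α β, G α β = G β α)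
    (h1 : ∀ β δ, ∑ ε, dG β δ ε * E ε = -∑ ε, G δ ε * Q β ε)
    (h2 : ∀ α β, ∑ ε, (E ε * dG ε α β + Q α ε * G ε β + Q β ε * G α ε) = k * G α β)
    (β γ : Fin n) :
    ∑ ε, ((1 / 2 : ℂ) * ∑ δ, X γ δ * (dG β δ ε + dG ε β δ - dG δ β ε)) * E ε
      = k / 2 * (if γ = β then 1 else 0) - Q β γ := by
  have hXG := mul_eq_one_comm.1 hGX
  have hx : ∀ β, ∑ δ, X γ δ * G δ β = if γ = β then 1 else 0 := fun β => by
    rw [← Matrix.mul_apply, hXG, Matrix.one_apply]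
  calc ∑ ε, ((1 / 2 : ℂ) * ∑ δ, X γ δ * (dG β δ ε + dG ε β δ - dG δ β ε)) * E ε
      = (1 / 2 : ℂ) * ∑ δ, X γ δ * ∑ ε, (dG β δ ε + dG ε β δ - dG δ β ε) * E ε := by
        simp only [Finset.mul_sum, Finset.sum_mul]
        rw [Finset.sum_comm]
        refine Finset.sum_congr rfl fun _ _ => Finset.sum_congr rfl fun _ _ => by ring
    _ = (1 / 2 : ℂ) * ∑ δ, X γ δ * (k * G δ β - 2 * ∑ ε, Q β ε * G δ ε) := by
        congr 1
        refine Finset.sum_congr rfl fun δ _ => ?_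
        rw [sum_koszul_mul_euler hsymm h1 h2, hsymm β δ]
        simp only [hsymm δ]
    _ = k / 2 * (∑ δ, X γ δ * G δ β) - ∑ ε, Q β ε * ∑ δ, X γ δ * G δ ε := by
        simp only [mul_sub, Finset.sum_sub_distrib, Finset.mul_sum]
        congr 1
        · exact Finset.sum_congr rfl fun _ _ => by ring
        · rw [Finset.sum_comm]
          exact Finset.sum_congr rfl fun _ _ => Finset.sum_congr rfl fun _ _ => by ring
    _ = _ := by
        simp only [hx]
        simp

/-- The same fact for the covector `a` obtained by lowering `E`: as `a` is constant in the
application, `∇a = -Γ a`, which equals `(k / 2) G`. Raising the index of `a` returns `E` (`hx`), so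
`h1` and `h2` again apply. -/
theorem sum_christoffel_mul_covector (hGX : G * X = 1) (hsymm : ∀ α β, G α β = G β α)
    (hdsymm : ∀ γ α β, dG γ α β = dG γ β α)
    (h1 : ∀ β δ, ∑ ε, dG β δ ε * E ε = -∑ ε, G δ ε * Q β ε)
    (h2 : ∀ α β, ∑ ε, (E ε * dG ε α β + Q α ε * G ε β + Q β ε * G α ε) = k * G α β)
    (ha : ∀ α, ∑ ε, G α ε * E ε = a α) (α β : Fin n) :
    ∑ γ, ((1 / 2 : ℂ) * ∑ δ, X γ δ * (dG α δ β + dG β α δ - dG δ α β)) * a γ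
      = -(k / 2) * G α β := by
  have hx : ∀ δ, ∑ γ, a γ * X γ δ = E δ := fun δ => by
    calc ∑ γ, a γ * X γ δ = ∑ ε, E ε * ∑ γ, G ε γ * X γ δ := by
          simp only [← ha, Finset.mul_sum, Finset.sum_mul]
          rw [Finset.sum_comm]
          refine Finset.sum_congr rfl fun ε _ => Finset.sum_congr rfl fun γ _ => ?_
          rw [hsymm γ ε]; ring
      _ = E δ := by simp only [← Matrix.mul_apply, hGX, Matrix.one_apply]; simp
  have e1 := h1 α β
  have e2 := h1 β α
  have e3 := h2 α β
  simp only [Finset.sum_add_distrib] at e3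
  have e4 : ∑ ε, Q α ε * G ε β = ∑ ε, G β ε * Q α ε :=
    Finset.sum_congr rfl fun ε _ => by rw [hsymm β ε]; ring
  have e5 : ∑ ε, Q β ε * G α ε = ∑ ε, G α ε * Q β ε :=
    Finset.sum_congr rfl fun ε _ => by ring
  calc ∑ γ, ((1 / 2 : ℂ) * ∑ δ, X γ δ * (dG α δ β + dG β α δ - dG δ α β)) * a γ
      = (1 / 2 : ℂ) * ∑ δ, (∑ γ, a γ * X γ δ) * (dG α δ β + dG β α δ - dG δ α β) := by
        simp only [Finset.mul_sum, Finset.sum_mul]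
        rw [Finset.sum_comm]
        exact Finset.sum_congr rfl fun _ _ => Finset.sum_congr rfl fun _ _ => by ring
    _ = (1 / 2 : ℂ) * (∑ δ, dG α β δ * E δ + ∑ δ, dG β α δ * E δ - ∑ δ, E δ * dG δ α β) := by
        simp only [hx, ← Finset.sum_add_distrib, ← Finset.sum_sub_distrib]
        congr 1
        refine Finset.sum_congr rfl fun δ _ => ?_
        rw [hdsymm α δ β]; ring
    _ = _ := by linear_combination (e1 + e2 - e3 + e4 + e5) / 2

end MatrixIdentities

end FrobeniusGeometry

namespace FrobeniusGeometry

/-! ### Differentiability of the inverse of a matrix function. -/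

section InverseMatrix

variable {E : Type*} [NormedAddCommGroup E] [NormedSpace ℂ E] {n : ℕ}
  {A : E → Matrix (Fin n) (Fin n) ℂ} {y : E}

theorem differentiableAt_det (h : ∀ i j, DifferentiableAt ℂ (fun x => A x i j) y) :
    DifferentiableAt ℂ (fun x => (A x).det) y := by
  simp only [Matrix.det_apply]
  refine DifferentiableAt.fun_sum fun σ _ => ?_
  refine DifferentiableAt.const_smul ?_ _
  exact (HasFDerivAt.finsetProd fun i _ => (h (σ i) i).hasFDerivAt).differentiableAt

theorem differentiableAt_inv (h : ∀ i j, DifferentiableAt ℂ (fun x => A x i j) y)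
    (hA : (A y).det ≠ 0) (i j : Fin n) : DifferentiableAt ℂ (fun x => (A x)⁻¹ i j) y := by
  simp only [Matrix.inv_def, Ring.inverse_eq_inv', Matrix.smul_apply, smul_eq_mul,
    Matrix.adjugate_apply]
  refine ((differentiableAt_det h).inv hA).mul (differentiableAt_det fun k l => ?_)
  by_cases hk : k = j
  · simp [hk]
  · simpa [Matrix.updateRow_ne hk] using h k l

end InverseMatrix

namespace FrobeniusManifold

/-! ### The intersection form in flat coordinates and its Lie derivative along `E`. -/

section FlatCoordinates

variable {n : ℕ} {M : Type*} [TopologicalSpace M] [ChartedSpace (Model n) M] {d : ℂ}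
  (F : FrobeniusManifold n M d) {φ : OpenPartialHomeomorph M (Model n)} {y : Model n}
  {A : Matrix (Fin n) (Fin n) ℂ}

theorem structConst_comm (χ : OpenPartialHomeomorph M (Model n)) (α β γ : Fin n) :
    structConst F.mul χ α β γ = structConst F.mul χ β α γ := by
  funext y
  simp only [structConst, F.mul_comm' _ (coordVec χ y α)]

theorem pd_gram_eq_zero (hA : ∀ y ∈ φ.target, ∀ α β, gram F.metric φ α β y = A α β)
    (hy : y ∈ φ.target) (α β γ : Fin n) : pd γ (gram F.metric φ α β) y = 0 := by
  have : gram F.metric φ α β =ᶠ[nhds y] fun _ => A α β := by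
    filter_upwards [φ.open_target.mem_nhds hy] with y' hy' using hA y' hy' α β
  rw [pd_congr this, pd_const]

theorem pd_euler_mul_gram (hφ : IsHolChart φ)
    (hA : ∀ y ∈ φ.target, ∀ α β, gram F.metric φ α β y = A α β) (hy : y ∈ φ.target)
    (α β : Fin n) :
    ∑ ε, pd α (vecComp F.euler φ ε) y * A ε β + ∑ ε, pd β (vecComp F.euler φ ε) y * A α ε
      = (2 - d) * A α β := by
  have := F.euler_metric φ hφ y hy α β
  simp only [F.pd_gram_eq_zero hA hy, hA y hy, mul_zero, zero_add, Finset.sum_add_distrib] at this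
  exact this

theorem structConst_zero [NeZero n] (hφ : F.IsUnitalFlatChart φ) (hy : y ∈ φ.target)
    (β γ : Fin n) : structConst F.mul φ 0 β γ y = if γ = β then 1 else 0 := by
  rw [structConst, ← hφ.2 y hy, F.unity_mul, coordDiff_coordVec hφ.1.1 hy]

/-- This is `[e, E] = e`, from `Lie_E (·) = ·` evaluated on `e · e = e`: the constant structure
coefficients leave `-∂_0 E + 2 ∂_0 E`. -/
theorem pd_zero_euler [NeZero n] (hφ : F.IsUnitalFlatChart φ) (hy : y ∈ φ.target) (γ : Fin n) :
    pd 0 (vecComp F.euler φ γ) y = if γ = 0 then 1 else 0 := by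
  have h := F.euler_mul φ hφ.1.1 y hy 0 0 γ
  have h0 : ∀ ε, pd ε (structConst F.mul φ 0 0 γ) y = 0 := fun ε => by
    have : structConst F.mul φ 0 0 γ =ᶠ[nhds y] fun _ => if γ = 0 then 1 else 0 := by
      filter_upwards [φ.open_target.mem_nhds hy] with y' hy' using F.structConst_zero hφ hy' 0 γ
    rw [pd_congr this, pd_const]
  simp only [F.structConst_comm φ _ 0, h0, F.structConst_zero hφ hy] at h
  simpa [Finset.sum_add_distrib] using h

/-- `⟨∂_λ · ∂_μ, E⟩` in flat coordinates. -/
theorem metric_mul_euler (hφ : IsHolChart φ)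
    (hA : ∀ y ∈ φ.target, ∀ α β, gram F.metric φ α β y = A α β) (hy : y ∈ φ.target)
    (α β : Fin n) :
    F.metric _ (F.mul _ (coordVec φ y α) (coordVec φ y β)) (F.euler (φ.symm y))
      = ∑ ρ, ∑ σ, structConst F.mul φ α β ρ y * A ρ σ * vecComp F.euler φ σ y := by
  rw [gram_eq_sum hφ F.metric hy rfl]
  refine Finset.sum_congr rfl fun ρ _ => Finset.sum_congr rfl fun σ _ => ?_
  rw [hA y hy]
  simp only [structConst, vecComp]
  ring

/-- The derivative of `⟨∂_λ · ∂_μ, E⟩` along `E`. -/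
theorem lie_metric_mul_euler (hφ : IsHolChart φ)
    (hA : ∀ y ∈ φ.target, ∀ α β, gram F.metric φ α β y = A α β) (hy : y ∈ φ.target)
    {K : Fin n → Fin n → Model n → ℂ}
    (hK : ∀ α β y, K α β y
      = ∑ ρ, ∑ σ, structConst F.mul φ α β ρ y * A ρ σ * vecComp F.euler φ σ y) (α β : Fin n) :
    ∑ ε, (vecComp F.euler φ ε y * pd ε (K α β) y + pd α (vecComp F.euler φ ε) y * K ε β y
      + pd β (vecComp F.euler φ ε) y * K α ε y) = (3 - d) * K α β y := by
  have hc : ∀ α β γ, DifferentiableAt ℂ (structConst F.mul φ α β γ) y := fun α β γ =>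
    (F.mul_analytic φ hφ α β γ y hy).differentiableAt
  have hE : ∀ γ, DifferentiableAt ℂ (vecComp F.euler φ γ) y := fun γ =>
    (F.euler_analytic φ hφ γ y hy).differentiableAt
  have hpK : ∀ ε, pd ε (K α β) y = ∑ ρ, ∑ σ, (pd ε (structConst F.mul φ α β ρ) y * A ρ σ
      * vecComp F.euler φ σ y
      + structConst F.mul φ α β ρ y * A ρ σ * pd ε (vecComp F.euler φ σ) y) := fun ε => by
    rw [show K α β = _ from funext (hK α β), pd_sum]
    · refine Finset.sum_congr rfl fun ρ _ => ?_
      rw [pd_sum]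
      · refine Finset.sum_congr rfl fun σ _ => ?_
        rw [pd_mul ((hc _ _ _).mul_const _) (hE _), pd_mul_const _ (hc _ _ _)]
      · exact fun σ _ => ((hc _ _ _).mul_const _).mul (hE _)
    · exact fun ρ _ => DifferentiableAt.fun_sum fun σ _ => ((hc _ _ _).mul_const _).mul (hE _)
  simp only [hpK, hK]
  have hm := F.euler_mul φ hφ y hy α β
  have hg := F.pd_euler_mul_gram hφ hA hy
  set c := fun α β γ => structConst F.mul φ α β γ y
  set E := fun γ => vecComp F.euler φ γ y
  set Q := fun α γ => pd α (vecComp F.euler φ γ) y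
  set dc := fun ε ρ => pd ε (structConst F.mul φ α β ρ) y
  have hm' : ∀ γ, ∑ ε, (E ε * dc ε γ - c α β ε * Q ε γ + Q α ε * c ε β γ + Q β ε * c α ε γ)
    = c α β γ := hm
  have hg' : ∀ α β, ∑ ε, Q α ε * A ε β + ∑ ε, Q β ε * A α ε = (2 - d) * A α β := hg
  change ∑ ε, (E ε * ∑ ρ, ∑ σ, (dc ε ρ * A ρ σ * E σ + c α β ρ * A ρ σ * Q ε σ)
    + Q α ε * ∑ ρ, ∑ σ, c ε β ρ * A ρ σ * E σ + Q β ε * ∑ ρ, ∑ σ, c α ε ρ * A ρ σ * E σ)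
    = (3 - d) * ∑ ρ, ∑ σ, c α β ρ * A ρ σ * E σ
  -- Subtracting and adding `c_{αβ}^ε (∂_ε E^ρ) A_{ρσ} E^σ` splits the sum into the Lie derivative
  -- of the product, contributing `1`, and that of the metric, contributing `2 - d`. The derivative
  -- of the factor `E` is absorbed in the second group, reflecting `[E, E] = 0`.
  have s1 : ∑ ε, (E ε * ∑ ρ, ∑ σ, (dc ε ρ * A ρ σ * E σ + c α β ρ * A ρ σ * Q ε σ)
      + Q α ε * ∑ ρ, ∑ σ, c ε β ρ * A ρ σ * E σ + Q β ε * ∑ ρ, ∑ σ, c α ε ρ * A ρ σ * E σ)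
      = ∑ ρ, ∑ σ, (∑ ε, (E ε * dc ε ρ - c α β ε * Q ε ρ + Q α ε * c ε β ρ + Q β ε * c α ε ρ))
        * A ρ σ * E σ
        + ∑ ρ, ∑ σ, (∑ ε, Q ρ ε * A ε σ + ∑ ε, Q σ ε * A ρ ε) * c α β ρ * E σ := by
    have t1 : ∑ ρ, ∑ σ, ∑ ε, c α β ε * Q ε ρ * A ρ σ * E σ
        = ∑ ρ, ∑ σ, ∑ ε, Q ρ ε * A ε σ * c α β ρ * E σ := by
      calc _ = ∑ σ, ∑ ρ, ∑ ε, c α β ε * Q ε ρ * A ρ σ * E σ := Finset.sum_comm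
        _ = ∑ σ, ∑ ρ, ∑ ε, Q ρ ε * A ε σ * c α β ρ * E σ := by
          refine Finset.sum_congr rfl fun σ _ => ?_
          rw [Finset.sum_comm]
          exact Finset.sum_congr rfl fun _ _ => Finset.sum_congr rfl fun _ _ => by ring
        _ = _ := Finset.sum_comm
    have t2 : ∑ ε, ∑ ρ, ∑ σ, E ε * (c α β ρ * A ρ σ * Q ε σ)
        = ∑ ρ, ∑ σ, ∑ ε, Q σ ε * A ρ ε * c α β ρ * E σ := by
      rw [Finset.sum_comm]
      exact Finset.sum_congr rfl fun _ _ => Finset.sum_congr rfl fun _ _ =>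
        Finset.sum_congr rfl fun _ _ => by ring
    have t3 : ∀ T : Fin n → Fin n → Fin n → ℂ,
        ∑ ε, ∑ ρ, ∑ σ, T ε ρ σ = ∑ ρ, ∑ σ, ∑ ε, T ε ρ σ := fun T => by
      rw [Finset.sum_comm]
      exact Finset.sum_congr rfl fun _ _ => Finset.sum_comm
    simp only [mul_add, add_mul, sub_mul, Finset.sum_add_distrib, Finset.sum_sub_distrib,
      Finset.mul_sum, Finset.sum_mul, t1, t2]
    rw [t3 fun ε ρ σ => E ε * (dc ε ρ * A ρ σ * E σ),
      t3 fun ε ρ σ => Q α ε * (c ε β ρ * A ρ σ * E σ),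
      t3 fun ε ρ σ => Q β ε * (c α ε ρ * A ρ σ * E σ)]
    simp only [← mul_assoc]
    ring
  rw [s1]
  simp only [hm', hg', Finset.mul_sum, ← Finset.sum_add_distrib]
  exact Finset.sum_congr rfl fun _ _ => Finset.sum_congr rfl fun _ _ => by ring

/-- In flat coordinates the contravariant Gram matrix is `B K B`, with `B` the inverse of the
Gram matrix of the metric and `K_{λμ} = ⟨∂_λ · ∂_μ, E⟩`. -/
theorem coGram_eq (hφ : IsHolChart φ)
    (hA : ∀ y ∈ φ.target, ∀ α β, gram F.metric φ α β y = A α β)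
    {B : Matrix (Fin n) (Fin n) ℂ} (hB : A * B = 1) (hy : y ∈ φ.target) :
    F.coGram φ y = B * Matrix.of (fun α β => ∑ ρ, ∑ σ,
      structConst F.mul φ α β ρ y * A ρ σ * vecComp F.euler φ σ y) * B := by
  have h1 : Matrix.of (fun α β => gram F.metric φ α β y) = A := by
    ext α β
    exact hA y hy α β
  have h2 : A * F.coGram φ y * A = Matrix.of (fun α β => ∑ ρ, ∑ σ,
      structConst F.mul φ α β ρ y * A ρ σ * vecComp F.euler φ σ y) := by
    ext α β
    have := F.gram_mul_coGram_mul_gram hφ hy α β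
    rw [h1, F.metric_mul_euler hφ hA hy] at this
    exact this
  rw [← h2]
  calc F.coGram φ y = (B * A) * F.coGram φ y * (A * B) := by
        rw [hB, mul_eq_one_comm.1 hB]; simp
    _ = _ := by noncomm_ring

/-- The matrix `B` is constant in flat coordinates, so differentiating `B K B` only touches `K`. -/
theorem differentiableAt_coGram (hφ : IsHolChart φ)
    (hA : ∀ y ∈ φ.target, ∀ α β, gram F.metric φ α β y = A α β)
    {B : Matrix (Fin n) (Fin n) ℂ} (hB : A * B = 1) (hy : y ∈ φ.target) (α β : Fin n) :
    DifferentiableAt ℂ (fun y' => F.coGram φ y' α β) y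
      ∧ ∀ ε, pd ε (fun y' => F.coGram φ y' α β) y
        = (B * Matrix.of (fun α β => pd ε (fun y => ∑ ρ, ∑ σ,
          structConst F.mul φ α β ρ y * A ρ σ * vecComp F.euler φ σ y) y) * B) α β := by
  have he : (fun y' => F.coGram φ y' α β) =ᶠ[nhds y] fun y' => ∑ μ, (∑ ν, B α ν *
      (∑ ρ, ∑ σ, structConst F.mul φ ν μ ρ y' * A ρ σ * vecComp F.euler φ σ y')) * B μ β := by
    filter_upwards [φ.open_target.mem_nhds hy] with y' hy'
    rw [F.coGram_eq hφ hA hB hy']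
    simp [Matrix.mul_apply]
  have hc : ∀ α β γ, DifferentiableAt ℂ (structConst F.mul φ α β γ) y := fun α β γ =>
    (F.mul_analytic φ hφ α β γ y hy).differentiableAt
  have hE : ∀ γ, DifferentiableAt ℂ (vecComp F.euler φ γ) y := fun γ =>
    (F.euler_analytic φ hφ γ y hy).differentiableAt
  have hK : ∀ ν μ, DifferentiableAt ℂ (fun y' => ∑ ρ, ∑ σ,
      structConst F.mul φ ν μ ρ y' * A ρ σ * vecComp F.euler φ σ y') y := fun ν μ =>
    DifferentiableAt.fun_sum fun ρ _ => DifferentiableAt.fun_sum fun σ _ =>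
      ((hc _ _ _).mul_const _).mul (hE _)
  have hBK : ∀ μ, DifferentiableAt ℂ (fun y' => ∑ ν, B α ν *
      (∑ ρ, ∑ σ, structConst F.mul φ ν μ ρ y' * A ρ σ * vecComp F.euler φ σ y')) y := fun μ =>
    DifferentiableAt.fun_sum fun ν _ => (hK ν μ).const_mul _
  refine ⟨he.differentiableAt_iff.2 (DifferentiableAt.fun_sum fun μ _ => (hBK μ).mul_const _),
    fun ε => ?_⟩
  rw [pd_congr he, pd_sum _ fun μ _ => (hBK μ).mul_const _, Matrix.mul_apply]
  refine Finset.sum_congr rfl fun μ _ => ?_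
  rw [pd_mul_const _ (hBK μ), pd_sum _ fun ν _ => (hK ν μ).const_mul _, Matrix.mul_apply]
  congr 1
  exact Finset.sum_congr rfl fun ν _ => pd_const_mul _ (hK ν μ)

theorem exists_right_inverse (hφ : IsHolChart φ)
    (hA : ∀ y ∈ φ.target, ∀ α β, gram F.metric φ α β y = A α β) (hy : y ∈ φ.target) :
    ∃ B : Matrix (Fin n) (Fin n) ℂ, A * B = 1 := by
  obtain ⟨B, hB⟩ := F.exists_gram_mul_eq_one hφ hy
  refine ⟨B, ?_⟩
  rw [← hB]
  congr 1
  ext α β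
  exact (hA y hy α β).symm

theorem differentiableAt_intGram (hφ : IsFlatChart F.metric φ) (hy : y ∈ φ.target)
    (hd : φ.symm y ∉ F.discriminant) (α β : Fin n) :
    DifferentiableAt ℂ (fun y' => F.intGram φ y' α β) y := by
  obtain ⟨hχ, A, hA⟩ := hφ
  obtain ⟨B, hB⟩ := F.exists_right_inverse hχ hA hy
  refine differentiableAt_inv (fun i j => (F.differentiableAt_coGram hχ hA hB hy i j).1) ?_ α β
  have := congrArg Matrix.det (F.intGram_mul_coGram hχ hy hd)
  rw [Matrix.det_mul, Matrix.det_one] at this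
  exact right_ne_zero_of_mul_eq_one this

/-- `Lie_E (∂_α, ∂_β) = (1 - d) (∂_α, ∂_β)` in flat coordinates. -/
theorem lie_intGram (hφ : IsFlatChart F.metric φ) (hy : y ∈ φ.target)
    (hd : ∀ᶠ y' in nhds y, φ.symm y' ∉ F.discriminant) (α β : Fin n) :
    ∑ ε, (vecComp F.euler φ ε y * pd ε (fun y' => F.intGram φ y' α β) y
      + pd α (vecComp F.euler φ ε) y * F.intGram φ y ε β
      + pd β (vecComp F.euler φ ε) y * F.intGram φ y α ε) = (1 - d) * F.intGram φ y α β := by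
  have hdG := F.differentiableAt_intGram hφ hy hd.self_of_nhds
  obtain ⟨hχ, A, hA⟩ := hφ
  obtain ⟨B, hB⟩ := F.exists_right_inverse hχ hA hy
  have hX := F.differentiableAt_coGram hχ hA hB hy
  set K : Fin n → Fin n → Model n → ℂ := fun α β y =>
    ∑ ρ, ∑ σ, structConst F.mul φ α β ρ y * A ρ σ * vecComp F.euler φ σ y
  set E := fun γ => vecComp F.euler φ γ y
  have hGX : ∀ i j ε, ∑ k, (pd ε (fun y' => F.intGram φ y' i k) y * F.coGram φ y k j
      + F.intGram φ y i k * pd ε (fun y' => F.coGram φ y' k j) y) = 0 := fun i j ε => by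
    have he : (fun y' => ∑ k, F.intGram φ y' i k * F.coGram φ y' k j) =ᶠ[nhds y]
        fun _ => (1 : Matrix (Fin n) (Fin n) ℂ) i j := by
      filter_upwards [hd, φ.open_target.mem_nhds hy] with y' hd' hy'
      rw [← Matrix.mul_apply, F.intGram_mul_coGram hχ hy' hd']
    have := pd_congr (α := ε) he
    rw [pd_const, pd_sum _ fun k _ => (hdG i k).fun_mul (hX k j).1] at this
    rw [← this]
    exact Finset.sum_congr rfl fun k _ => (pd_mul (hdG i k) (hX k j).1).symm
  -- `Q` is the Jacobian of `E`, and `DK`, `DX`, `DG` are derivatives along `E`. The side goals are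
  -- `K = A X A`, the scaling of the metric, the weight `3 - d` of `K`, the constancy of `B`, and
  -- the derivative of `G X = 1`.
  have key := lie_gram_of_lie_cogram (A := A) (B := B) (X := F.coGram φ y) (G := F.intGram φ y)
    (K := Matrix.of fun α β => K α β y)
    (Q := Matrix.of fun α ε => pd α (vecComp F.euler φ ε) y)
    (DK := Matrix.of fun α β => ∑ ε, E ε * pd ε (K α β) y)
    (DX := Matrix.of fun α β => ∑ ε, E ε * pd ε (fun y' => F.coGram φ y' α β) y)
    (DG := Matrix.of fun α β => ∑ ε, E ε * pd ε (fun y' => F.intGram φ y' α β) y) (d := d)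
    hB (F.intGram_mul_coGram hχ hy hd.self_of_nhds) ?_ ?_ ?_ ?_ ?_
  · have := congrFun (congrFun key α) β
    simp only [Matrix.add_apply, Matrix.mul_apply, Matrix.of_apply, Matrix.transpose_apply,
      Matrix.smul_apply, smul_eq_mul] at this
    rw [← this]
    simp only [Finset.sum_add_distrib]
    congr 1
    exact Finset.sum_congr rfl fun _ _ => mul_comm _ _
  · have hcg : F.coGram φ y = B * (Matrix.of fun α β => K α β y) * B :=
      F.coGram_eq hχ hA hB hy
    have hBA := mul_eq_one_comm.1 hB
    rw [hcg]
    generalize (Matrix.of fun α β => K α β y) = K'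
    calc K' = (A * B) * K' * (B * A) := by rw [hB, hBA, one_mul, mul_one]
      _ = _ := by simp only [mul_assoc]
  · ext α β
    simp only [Matrix.add_apply, Matrix.mul_apply, Matrix.of_apply, Matrix.transpose_apply,
      Matrix.smul_apply, smul_eq_mul]
    rw [← F.pd_euler_mul_gram hχ hA hy α β]
    congr 1
    exact Finset.sum_congr rfl fun _ _ => mul_comm _ _
  · ext α β
    simp only [Matrix.add_apply, Matrix.mul_apply, Matrix.of_apply, Matrix.transpose_apply,
      Matrix.smul_apply, smul_eq_mul]
    rw [← F.lie_metric_mul_euler hχ hA hy (K := K) (fun _ _ _ => rfl) α β]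
    simp only [Finset.sum_add_distrib]
    congr 1
    exact Finset.sum_congr rfl fun _ _ => mul_comm _ _
  · ext α β
    have hX2 : ∀ ε, pd ε (fun y' => F.coGram φ y' α β) y
        = (B * Matrix.of (fun α β => pd ε (K α β) y) * B) α β := (hX α β).2
    simp only [Matrix.of_apply, hX2]
    have : (Matrix.of fun α β => ∑ ε, E ε * pd ε (K α β) y)
        = ∑ ε, E ε • Matrix.of fun α β => pd ε (K α β) y := by
      ext i j
      simp [Matrix.sum_apply]
    rw [this]
    simp only [Finset.mul_sum, Finset.sum_mul, Matrix.sum_apply, Matrix.mul_smul, Matrix.smul_mul,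
      Matrix.smul_apply, smul_eq_mul]
  · ext i j
    simp only [Matrix.add_apply, Matrix.mul_apply, Matrix.of_apply, Matrix.zero_apply]
    calc _ = ∑ ε, E ε * ∑ k, (pd ε (fun y' => F.intGram φ y' i k) y * F.coGram φ y k j
          + F.intGram φ y i k * pd ε (fun y' => F.coGram φ y' k j) y) := by
          simp only [Finset.mul_sum, Finset.sum_mul, mul_add, Finset.sum_add_distrib]
          rw [Finset.sum_comm]
          congr 1
          · exact Finset.sum_congr rfl fun _ _ => Finset.sum_congr rfl fun _ _ => by ring
          · rw [Finset.sum_comm]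
            exact Finset.sum_congr rfl fun _ _ => Finset.sum_congr rfl fun _ _ => by ring
      _ = 0 := by simp only [hGX, mul_zero, Finset.sum_const_zero]

/-! ### Covariant derivatives of `E` and `dt_1` for `∇_*`. -/

theorem intGram_symm (hφ : IsHolChart φ) (hy : y ∈ φ.target) (hd : φ.symm y ∉ F.discriminant)
    (α β : Fin n) : F.intGram φ y α β = F.intGram φ y β α := by
  rw [F.intGram_eq hφ hy hd, F.intGram_eq hφ hy hd, gram_tanForm_symm]

theorem pd_intGram_symm (hφ : IsHolChart φ) (hy : y ∈ φ.target)
    (hd : ∀ᶠ y' in nhds y, φ.symm y' ∉ F.discriminant) (γ α β : Fin n) :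
    pd γ (fun y' => F.intGram φ y' α β) y = pd γ (fun y' => F.intGram φ y' β α) y := by
  refine pd_congr ?_
  filter_upwards [hd, φ.open_target.mem_nhds hy] with y' hd' hy'
  exact F.intGram_symm hφ hy' hd' α β

/-- The lowered Euler field is `dt_1`, whose components `η_{1α}` are constant. -/
theorem sum_intGram_mul_euler_unital [NeZero n] (hφ : F.IsUnitalFlatChart φ)
    (hA : ∀ y ∈ φ.target, ∀ α β, gram F.metric φ α β y = A α β) (hy : y ∈ φ.target)
    (hd : φ.symm y ∉ F.discriminant) (α : Fin n) :
    ∑ β, F.intGram φ y α β * vecComp F.euler φ β y = A 0 α := by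
  rw [F.sum_intGram_mul_euler hφ.1.1 hy hd, hφ.2 y hy, F.metric_symm, ← hA y hy]
  rfl

theorem sum_pd_intGram_mul_euler [NeZero n] (hφ : F.IsUnitalFlatChart φ) (hy : y ∈ φ.target)
    (hd : ∀ᶠ y' in nhds y, φ.symm y' ∉ F.discriminant) (β δ : Fin n) :
    ∑ ε, pd β (fun y' => F.intGram φ y' δ ε) y * vecComp F.euler φ ε y
      = -∑ ε, F.intGram φ y δ ε * pd β (vecComp F.euler φ ε) y := by
  obtain ⟨hχ, A, hA⟩ := hφ.1
  have hdG := F.differentiableAt_intGram hφ.1 hy hd.self_of_nhds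
  have hE : ∀ γ, DifferentiableAt ℂ (vecComp F.euler φ γ) y := fun γ =>
    (F.euler_analytic φ hχ γ y hy).differentiableAt
  have he : (fun y' => ∑ ε, F.intGram φ y' δ ε * vecComp F.euler φ ε y') =ᶠ[nhds y]
      fun _ => A 0 δ := by
    filter_upwards [hd, φ.open_target.mem_nhds hy] with y' hd' hy'
    exact F.sum_intGram_mul_euler_unital hφ hA hy' hd' δ
  have := pd_congr (α := β) he
  rw [pd_const, pd_sum _ fun ε _ => (hdG δ ε).fun_mul (hE ε)] at this
  rw [eq_neg_iff_add_eq_zero, ← this, ← Finset.sum_add_distrib]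
  exact Finset.sum_congr rfl fun ε _ => (pd_mul (hdG δ ε) (hE ε)).symm

/-- `∇_* E = (1 - d) / 2` in flat coordinates. -/
theorem sum_christoffel_mul_euler_flat [NeZero n] (hφ : F.IsUnitalFlatChart φ)
    (hy : y ∈ φ.target) (hd : ∀ᶠ y' in nhds y, φ.symm y' ∉ F.discriminant) (β γ : Fin n) :
    ∑ ε, F.christoffel φ β ε γ y * vecComp F.euler φ ε y
      = (1 - d) / 2 * (if γ = β then 1 else 0) - pd β (vecComp F.euler φ γ) y :=
  sum_christoffel_mul_euler (G := F.intGram φ y) (X := F.coGram φ y)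
    (Q := fun α ε => pd α (vecComp F.euler φ ε) y)
    (dG := fun γ α β => pd γ (fun y' => F.intGram φ y' α β) y)
    (F.intGram_mul_coGram hφ.1.1 hy hd.self_of_nhds)
    (F.intGram_symm hφ.1.1 hy hd.self_of_nhds)
    (F.sum_pd_intGram_mul_euler hφ hy hd) (F.lie_intGram hφ.1 hy hd) β γ

/-- `∇_* dt_1 (∂_α, ∂_β) = (1 - d) / 2 (∂_α, ∂_β)` in flat coordinates. -/
theorem sum_christoffel_mul_metric [NeZero n] (hφ : F.IsUnitalFlatChart φ)
    (hA : ∀ y ∈ φ.target, ∀ α β, gram F.metric φ α β y = A α β)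
    (hy : y ∈ φ.target) (hd : ∀ᶠ y' in nhds y, φ.symm y' ∉ F.discriminant) (α β : Fin n) :
    ∑ γ, F.christoffel φ α β γ y * A 0 γ = -((1 - d) / 2) * F.intGram φ y α β :=
  sum_christoffel_mul_covector (G := F.intGram φ y) (X := F.coGram φ y)
    (Q := fun α ε => pd α (vecComp F.euler φ ε) y)
    (dG := fun γ α β => pd γ (fun y' => F.intGram φ y' α β) y)
    (F.intGram_mul_coGram hφ.1.1 hy hd.self_of_nhds)
    (F.intGram_symm hφ.1.1 hy hd.self_of_nhds)
    (F.pd_intGram_symm hφ.1.1 hy hd)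
    (F.sum_pd_intGram_mul_euler hφ hy hd) (F.lie_intGram hφ.1 hy hd)
    (F.sum_intGram_mul_euler_unital hφ hA hy hd.self_of_nhds) α β

end FlatCoordinates

end FrobeniusManifold

end FrobeniusGeometry

namespace FrobeniusGeometry

/-! ### Euler's theorem along complex exponential paths. -/

theorem hasDerivAt_exp_smul {n : ℕ} {f : Model n → ℂ} {y : Model n} (m τ w : ℂ)
    (hf : DifferentiableAt ℂ f (Complex.exp (w * τ) • y))
    (h : ∑ i, (Complex.exp (w * τ) • y) i * pd i f (Complex.exp (w * τ) • y)
      = m * f (Complex.exp (w * τ) • y)) :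
    HasDerivAt (fun s : ℂ => Complex.exp (s * -(m * τ)) * f (Complex.exp (s * τ) • y)) 0 w := by
  have h1 : ∀ c : ℂ, HasDerivAt (fun s : ℂ => Complex.exp (s * c)) (Complex.exp (w * c) * c) w :=
    fun c => by simpa using ((hasDerivAt_id w).mul_const c).cexp
  have h2 := hf.hasFDerivAt.comp_hasDerivAt w ((h1 τ).smul_const y)
  have h3 := (h1 (-(m * τ))).mul h2
  convert! h3 using 1
  have h4 : (Complex.exp (w * τ) * τ) • y = τ • (Complex.exp (w * τ) • y) := by
    rw [smul_smul, mul_comm]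
  rw [h4, map_smul, fderiv_apply_eq_sum, h, smul_eq_mul]
  simp only [Function.comp_apply]
  ring

/-- Euler's theorem on homogeneous functions. -/
theorem isHomogeneousOn_of_euler {n : ℕ} {f : Model n → ℂ} {W : Set (Model n)} {m : ℂ}
    (hf : ∀ y ∈ W, DifferentiableAt ℂ f y) (h : ∀ y ∈ W, ∑ i, y i * pd i f y = m * f y) :
    IsHomogeneousOn f W m := by
  intro y _ τ hτ
  -- Euler's identity makes `exp (-s m τ) f (exp (s τ) y)` stationary on the whole path; its values
  -- at `0` and `1` give the claim.
  have hd : ∀ s ∈ Set.Icc (0 : ℝ) 1, HasDerivAt (fun s : ℝ =>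
      Complex.exp ((s : ℂ) * -(m * τ)) * f (Complex.exp ((s : ℂ) * τ) • y)) 0 s := fun s hs =>
    (hasDerivAt_exp_smul m τ s (hf _ (hτ s hs)) (h _ (hτ s hs))).comp_ofReal
  have hc := constant_of_has_deriv_right_zero
    (fun s hs => (hd s hs).continuousAt.continuousWithinAt)
    (fun s hs => (hd s ⟨hs.1, hs.2.le⟩).hasDerivWithinAt) 1 (by simp)
  simp only [Complex.ofReal_one, Complex.ofReal_zero, one_mul, zero_mul, Complex.exp_zero,
    one_smul] at hc
  rw [← hc, ← mul_assoc, ← Complex.exp_add]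
  simp

namespace FrobeniusManifold

/-! ### Twisted periods: quasihomogeneity and the Hessian in flat coordinates. -/

section TwistedPeriods

variable {n : ℕ} {M : Type*} [TopologicalSpace M] [ChartedSpace (Model n) M] {d ν : ℂ}
  (F : FrobeniusManifold n M d) {φ ψ : OpenPartialHomeomorph M (Model n)} {y : Model n}
  {A : Matrix (Fin n) (Fin n) ℂ}

theorem eventually_notMem_discriminant {W : Set M} (hW : IsOpen W)
    (hWd : W ⊆ F.discriminantᶜ) (hy : y ∈ φ.target) (hy' : φ.symm y ∈ W) :
    ∀ᶠ t in nhds y, φ.symm t ∉ F.discriminant := by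
  filter_upwards [(φ.continuousAt_symm hy).eventually (hW.mem_nhds hy')] with t ht using hWd ht

theorem lieE_eq_sum (hφ : IsHolChart φ) (hy : y ∈ φ.target) {p : M → ℂ}
    (hp : MDifferentiableAt 𝓘(ℂ, Model n) 𝓘(ℂ, ℂ) p (φ.symm y)) :
    F.lieE p (φ.symm y) = ∑ ε, vecComp F.euler φ ε y * pd ε (p ∘ φ.symm) y :=
  mfderiv_apply_eq_sum hφ hy hp _

/-- A holomorphic function with `d (Lie_E p) = k dp`, `k ≠ 0`, becomes quasihomogeneous after
the addition of a constant. -/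
theorem exists_lieE_add_const (hφ : IsHolChart φ) {W : Set M} (hW : IsOpen W) (hWφ : W ⊆ φ.source)
    (hc : IsPreconnected W) {p : M → ℂ} {k : ℂ} (hk : k ≠ 0)
    (hp : ∀ x ∈ W, MDifferentiableAt 𝓘(ℂ, Model n) 𝓘(ℂ, ℂ) p x)
    (hP : ∀ y ∈ φ '' W, AnalyticAt ℂ (p ∘ φ.symm) y)
    (h : ∀ y ∈ φ '' W, ∀ β, pd β (fun y' => ∑ ε, vecComp F.euler φ ε y' * pd ε (p ∘ φ.symm) y') y
      = k * pd β (p ∘ φ.symm) y) :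
    ∃ a : ℂ, ∀ x ∈ W, F.lieE (fun x' => p x' + a) x = k * (p x + a) := by
  set P := p ∘ φ.symm
  set L : Model n → ℂ := fun y' => ∑ ε, vecComp F.euler φ ε y' * pd ε P y'
  have hU : ∀ y ∈ φ '' W, y ∈ φ.target := by
    rintro _ ⟨x, hx, rfl⟩
    exact φ.map_source (hWφ hx)
  have hL : ∀ y ∈ φ '' W, DifferentiableAt ℂ L y := fun y hy =>
    DifferentiableAt.fun_sum fun ε _ =>
      ((F.euler_analytic φ hφ ε y (hU y hy)).differentiableAt).mul
        (analyticAt_pd (hP y hy)).differentiableAt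
  have hkP : ∀ y ∈ φ '' W, DifferentiableAt ℂ (fun y => k * P y) y := fun y hy =>
    (hP y hy).differentiableAt.const_mul _
  obtain ⟨c, hc⟩ := (φ.isOpen_image_of_subset_source hW hWφ).exists_is_const_of_fderiv_eq_zero
    (𝕜 := ℂ) (f := fun y => L y - k * P y) (hc.image _ (φ.continuousOn.mono hWφ))
    (fun y hy => ((hL y hy).sub (hkP y hy)).differentiableWithinAt)
    (fun y hy => fderiv_eq_zero_of_pd fun β => by
      rw [pd_sub (hL y hy) (hkP y hy), pd_const_mul _ (hP y hy).differentiableAt, h y hy, sub_self])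
  -- On the connected image `Lie_E p - k p` is a constant `c`, and adding `c / k` to `p` absorbs it.
  refine ⟨c / k, fun x hx => ?_⟩
  have hx' : φ.symm (φ x) = x := φ.left_inv (hWφ hx)
  have hxU : φ x ∈ φ '' W := ⟨x, hx, rfl⟩
  have hpa : MDifferentiableAt 𝓘(ℂ, Model n) 𝓘(ℂ, ℂ) (fun x' => p x' + c / k) x :=
    (hp x hx).add mdifferentiableAt_const
  have h1 : F.lieE (fun x' => p x' + c / k) (φ.symm (φ x)) = L (φ x) := by
    rw [F.lieE_eq_sum hφ (hU _ hxU) (by rw [hx']; exact hpa)]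
    refine Finset.sum_congr rfl fun ε _ => ?_
    congr 1
    simp only [pd]
    congr 1
    exact fderiv_add_const (f := P) (c / k)
  rw [hx'] at h1
  have h2 : P (φ x) = p x := congrArg p hx'
  have h3 : L (φ x) - k * P (φ x) = c := hc _ hxU
  rw [h1, ← h2, mul_add, mul_div_cancel₀ _ hk, ← h3]
  ring

theorem lowerT_symm [NeZero n] (hA : ∀ y ∈ φ.target, ∀ α β, gram F.metric φ α β y = A α β)
    (hy : y ∈ φ.target) : F.lowerT φ (φ.symm y) = ∑ α, A 0 α * y α := by
  simp only [lowerT, φ.right_inv hy, hA y hy]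

theorem lowerT_eq [NeZero n] (hA : ∀ y ∈ φ.target, ∀ α β, gram F.metric φ α β y = A α β)
    {x : M} (hx : x ∈ φ.source) : F.lowerT φ x = ∑ α, A 0 α * φ x α := by
  simp only [lowerT, hA _ (φ.map_source hx)]

theorem analyticAt_linear (a : Fin n → ℂ) (y : Model n) :
    AnalyticAt ℂ (fun t : Model n => ∑ α, a α * t α) y := by
  refine Finset.analyticAt_fun_sum _ fun α _ => analyticAt_const.mul ?_
  exact (ContinuousLinearMap.proj (R := ℂ) (φ := fun _ : Fin n => ℂ) α).analyticAt y

theorem pd_linear (a : Fin n → ℂ) (y : Model n) (β : Fin n) :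
    pd β (fun t : Model n => ∑ α, a α * t α) y = a β := by
  have h : ∀ α, DifferentiableAt ℂ (fun t : Model n => t α) y := fun α =>
    (ContinuousLinearMap.proj (R := ℂ) (φ := fun _ : Fin n => ℂ) α).differentiableAt
  rw [pd_sum _ fun α _ => (h α).const_mul _]
  simp only [pd_const_mul _ (h _), pd_apply]
  simp

theorem lowerT_comp_symm_eventuallyEq [NeZero n]
    (hA : ∀ y ∈ φ.target, ∀ α β, gram F.metric φ α β y = A α β) (hy : y ∈ φ.target) :
    F.lowerT φ ∘ φ.symm =ᶠ[nhds y] fun t => ∑ α, A 0 α * t α := by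
  filter_upwards [φ.open_target.mem_nhds hy] with t ht using F.lowerT_symm hA ht

theorem mdifferentiableAt_lowerT [NeZero n] (hφ : IsHolChart φ)
    (hA : ∀ y ∈ φ.target, ∀ α β, gram F.metric φ α β y = A α β) {x : M} (hx : x ∈ φ.source) :
    MDifferentiableAt 𝓘(ℂ, Model n) 𝓘(ℂ, ℂ) (F.lowerT φ) x := by
  have h1 := ((analyticAt_linear (A 0) (φ x)).differentiableAt.mdifferentiableAt).comp x
    (hφ.mdifferentiableAt hx)
  refine h1.congr_of_eventuallyEq ?_
  filter_upwards [φ.open_source.mem_nhds hx] with x' hx' using F.lowerT_eq hA hx'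

/-- `d (Lie_E t_1) = (1 - d) dt_1`. -/
theorem pd_lie_lowerT [NeZero n] (hφ : F.IsUnitalFlatChart φ)
    (hA : ∀ y ∈ φ.target, ∀ α β, gram F.metric φ α β y = A α β) (hy : y ∈ φ.target) (β : Fin n) :
    pd β (fun y' => ∑ ε, vecComp F.euler φ ε y' * pd ε (F.lowerT φ ∘ φ.symm) y') y
      = (1 - d) * pd β (F.lowerT φ ∘ φ.symm) y := by
  have hE : ∀ γ, DifferentiableAt ℂ (vecComp F.euler φ γ) y := fun γ =>
    (F.euler_analytic φ hφ.1.1 γ y hy).differentiableAt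
  have hpd : ∀ y' ∈ φ.target, ∀ ε, pd ε (F.lowerT φ ∘ φ.symm) y' = A 0 ε := fun y' hy' ε => by
    rw [pd_congr (F.lowerT_comp_symm_eventuallyEq hA hy'), pd_linear]
  have he : (fun y' => ∑ ε, vecComp F.euler φ ε y' * pd ε (F.lowerT φ ∘ φ.symm) y')
      =ᶠ[nhds y] fun y' => ∑ ε, vecComp F.euler φ ε y' * A 0 ε := by
    filter_upwards [φ.open_target.mem_nhds hy] with y' hy'
    simp only [hpd y' hy']
  have hAs : ∀ α β, A α β = A β α := fun α β => by
    rw [← hA y hy, ← hA y hy, gram, F.metric_symm]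
    rfl
  rw [pd_congr he, hpd y hy, pd_sum _ fun ε _ => (hE ε).mul_const _]
  simp only [pd_mul_const _ (hE _)]
  -- Pairing with `e` and using `[e, E] = e` lowers the factor from `2 - d` to `1 - d`.
  have h := F.pd_euler_mul_gram hφ.1.1 hA hy β 0
  simp only [F.pd_zero_euler hφ hy, ite_mul, one_mul, zero_mul, Finset.sum_ite_eq',
    Finset.mem_univ, if_true, hAs _ 0] at h
  linear_combination h

/-- `d (Lie_E p) = ((1 - d) / 2 + ν) dp` for a twisted period `p` with parameter `ν`. -/
theorem pd_lie_twisted [NeZero n] (hφ : F.IsUnitalFlatChart φ) (hy : y ∈ φ.target)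
    (hd : ∀ᶠ y' in nhds y, φ.symm y' ∉ F.discriminant) {P : Model n → ℂ} (hP : AnalyticAt ℂ P y)
    (h : ∀ α β, pd α (pd β P) y - ∑ γ, F.christoffel φ α β γ y * pd γ P y
        = ν * ∑ γ, structConst F.dualMul φ α β γ y * pd γ P y) (β : Fin n) :
    pd β (fun y' => ∑ ε, vecComp F.euler φ ε y' * pd ε P y') y
      = ((1 - d) / 2 + ν) * pd β P y := by
  have hE : ∀ γ, DifferentiableAt ℂ (vecComp F.euler φ γ) y := fun γ =>
    (F.euler_analytic φ hφ.1.1 γ y hy).differentiableAt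
  have hdP : ∀ γ, DifferentiableAt ℂ (pd γ P) y := fun γ => (analyticAt_pd hP).differentiableAt
  rw [pd_sum _ fun ε _ => (hE ε).fun_mul (hdP ε)]
  simp only [pd_mul (hE _) (hdP _)]
  have h' : ∀ ε, pd β (pd ε P) y = ∑ γ, F.christoffel φ β ε γ y * pd γ P y
    + ν * ∑ γ, structConst F.dualMul φ β ε γ y * pd γ P y := fun ε => by
      linear_combination h β ε
  -- Contracting the twisted period equation with `E`: the Christoffel part gives `(1 - d) / 2`
  -- minus the Jacobian of `E`, which cancels the remaining product rule term, and `u * E = u`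
  -- leaves `ν`.
  have s1 : ∑ ε, vecComp F.euler φ ε y * pd β (pd ε P) y
      = ∑ γ, (∑ ε, F.christoffel φ β ε γ y * vecComp F.euler φ ε y) * pd γ P y
      + ν * ∑ γ, (∑ ε, structConst F.dualMul φ β ε γ y * vecComp F.euler φ ε y) * pd γ P y := by
    simp only [h', mul_add, Finset.sum_add_distrib, Finset.mul_sum, Finset.sum_mul]
    congr 1 <;> rw [Finset.sum_comm] <;>
      exact Finset.sum_congr rfl fun _ _ => Finset.sum_congr rfl fun _ _ => by ring
  rw [Finset.sum_add_distrib, s1]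
  simp only [F.sum_christoffel_mul_euler_flat hφ hy hd,
    F.sum_structConst_dualMul_mul_euler hφ.1.1 hy hd.self_of_nhds, sub_mul,
    Finset.sum_sub_distrib]
  simp
  ring

/-- The intersection form is the Hessian, with respect to coordinates `z = Z(t)` consisting of
twisted periods, of the multiple `f` of `t_1`: the components in the flat coordinates `t`. -/
theorem sum_hessian_eq_intGram [NeZero n] (hν : ν ≠ (1 - d) / 2) (hφ : F.IsUnitalFlatChart φ)
    (hA : ∀ y ∈ φ.target, ∀ α β, gram F.metric φ α β y = A α β) (hy : y ∈ φ.target)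
    (hd : ∀ᶠ y' in nhds y, φ.symm y' ∉ F.discriminant) {Z : Model n → Model n}
    {f : Model n → ℂ} (hZ : AnalyticAt ℂ Z y) (hf : AnalyticAt ℂ f (Z y))
    (hfZ : (fun t => f (Z t)) =ᶠ[nhds y] fun t => ((1 - d) / 2 - ν)⁻¹ * ∑ α, A 0 α * t α)
    (h : ∀ i α β, pd α (pd β fun t => Z t i) y
      - ∑ γ, F.christoffel φ α β γ y * pd γ (fun t => Z t i) y
        = ν * ∑ γ, structConst F.dualMul φ α β γ y * pd γ (fun t => Z t i) y) (α β : Fin n) :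
    ∑ i, ∑ j, pd α (fun t => Z t i) y * pd β (fun t => Z t j) y * pd i (pd j f) (Z y)
      = F.intGram φ y α β := by
  set κ := ((1 - d) / 2 - ν)⁻¹
  have hκ' : κ * ((1 - d) / 2 - ν) = 1 := inv_mul_cancel₀ (sub_ne_zero.2 hν.symm)
  have hZi : ∀ t, AnalyticAt ℂ Z t → ∀ i, AnalyticAt ℂ (fun t => Z t i) t := fun t ht i =>
    ((ContinuousLinearMap.proj (R := ℂ) (φ := fun _ : Fin n => ℂ) i).analyticAt _).comp ht
  -- Chain rule for `f ∘ Z = κ t_1`. It is proved near `y`, not only at `y`, because it is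
  -- differentiated again below.
  have h1 : ∀ γ, (fun t => ∑ i, pd γ (fun t => Z t i) t * pd i f (Z t)) =ᶠ[nhds y]
      fun _ => κ * A 0 γ := fun γ => by
    filter_upwards [hfZ.eventuallyEq_nhds, hZ.eventually_analyticAt,
      hZ.continuousAt.eventually hf.eventually_analyticAt] with t ht hZt hft
    rw [← pd_comp hft.differentiableAt hZt.differentiableAt, pd_congr ht,
      pd_const_mul _ (analyticAt_linear (A 0) t).differentiableAt, pd_linear]
  have hdZ : ∀ γ i, DifferentiableAt ℂ (pd γ fun t => Z t i) y := fun γ i =>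
    (analyticAt_pd (hZi y hZ i)).differentiableAt
  have hdf : ∀ i, DifferentiableAt ℂ (pd i f) (Z y) := fun i =>
    (analyticAt_pd hf).differentiableAt
  have hdfZ : ∀ i, DifferentiableAt ℂ (fun t => pd i f (Z t)) y := fun i =>
    ((analyticAt_pd hf).comp hZ).differentiableAt
  have h2 := pd_congr (α := α) (h1 β)
  rw [pd_const, pd_sum _ fun i _ => (hdZ β i).fun_mul (hdfZ i)] at h2
  simp only [pd_mul (hdZ β _) (hdfZ _), pd_comp (hdf _) hZ.differentiableAt] at h2
  have h3 : ∀ γ, ∑ i, pd γ (fun t => Z t i) y * pd i f (Z y) = κ * A 0 γ := fun γ =>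
    (h1 γ).self_of_nhds
  have h' : ∀ i, pd α (pd β fun t => Z t i) y
      = ∑ γ, F.christoffel φ α β γ y * pd γ (fun t => Z t i) y
        + ν * ∑ γ, structConst F.dualMul φ α β γ y * pd γ (fun t => Z t i) y := fun i => by
    linear_combination h i α β
  have hC : ∑ γ, structConst F.dualMul φ α β γ y * A 0 γ = F.intGram φ y α β := by
    rw [← F.sum_structConst_dualMul_mul_metric hφ.1.1 hy hd.self_of_nhds]
    refine Finset.sum_congr rfl fun γ _ => ?_
    rw [hφ.2 y hy, F.metric_symm, ← hA y hy]
    rfl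
  -- Substituting the twisted period equation gives `κ (-(1 - d) / 2 + ν) ( , ) = -( , )`; this
  -- fixes the normalization of `f`.
  have s1 : ∑ i, pd α (pd β fun t => Z t i) y * pd i f (Z y) = -F.intGram φ y α β := by
    calc _ = ∑ γ, F.christoffel φ α β γ y * ∑ i, pd γ (fun t => Z t i) y * pd i f (Z y)
        + ν * ∑ γ, structConst F.dualMul φ α β γ y
          * ∑ i, pd γ (fun t => Z t i) y * pd i f (Z y) := by
          simp only [h', add_mul, Finset.sum_add_distrib, Finset.mul_sum, Finset.sum_mul]
          congr 1 <;> rw [Finset.sum_comm] <;>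
            exact Finset.sum_congr rfl fun _ _ => Finset.sum_congr rfl fun _ _ => by ring
      _ = κ * ∑ γ, F.christoffel φ α β γ y * A 0 γ
        + ν * (κ * ∑ γ, structConst F.dualMul φ α β γ y * A 0 γ) := by
          simp only [h3, Finset.mul_sum]
          congr 1
          · exact Finset.sum_congr rfl fun _ _ => by ring
          · exact Finset.sum_congr rfl fun _ _ => by ring
      _ = _ := by
          rw [F.sum_christoffel_mul_metric hφ hA hy hd, hC]
          linear_combination -F.intGram φ y α β * hκ'
  rw [Finset.sum_add_distrib, s1] at h2
  rw [neg_add_eq_zero.1 h2, Finset.sum_comm]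
  simp only [Finset.mul_sum]
  exact Finset.sum_congr rfl fun _ _ => Finset.sum_congr rfl fun _ _ => by ring

variable [IsManifold 𝓘(ℂ, Model n) ω M]

/-- The Jacobian matrix of a coordinate change is invertible. -/
theorem exists_jacobian_mul_eq_one (hφ : IsHolChart φ) (hψ : IsHolChart ψ)
    (hy : y ∈ φ.target) (hy' : φ.symm y ∈ ψ.source) :
    ∃ J : Matrix (Fin n) (Fin n) ℂ,
      Matrix.of (fun i α => pd α (fun t => ψ (φ.symm t) i) y) * J = 1 := by
  set z := ψ (φ.symm y)
  have hzt : z ∈ ψ.target := ψ.map_source hy'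
  have hzs : ψ.symm z = φ.symm y := ψ.left_inv hy'
  have hzφ : ψ.symm z ∈ φ.source := hzs ▸ φ.map_target hy
  have hy2 : φ (ψ.symm z) = y := by rw [hzs, φ.right_inv hy]
  refine ⟨Matrix.of fun α j => pd j (fun s => φ (ψ.symm s) α) z, ?_⟩
  ext i j
  have h1 : AnalyticAt ℂ (fun t => ψ (φ.symm t) i) y :=
    ((ContinuousLinearMap.proj (R := ℂ) (φ := fun _ : Fin n => ℂ) i).analyticAt _).comp
      (analyticAt_transition hφ hψ hy hy')
  have h2 := pd_comp (α := j) (f := fun t => ψ (φ.symm t) i) (Z := fun s => φ (ψ.symm s)) (y := z)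
    (by simpa only [hy2] using h1.differentiableAt)
    (analyticAt_transition hψ hφ hzt hzφ).differentiableAt
  have he : (fun s => ψ (φ.symm (φ (ψ.symm s))) i) =ᶠ[nhds z] fun s => s i := by
    filter_upwards [ψ.open_target.mem_nhds hzt,
      (ψ.continuousAt_symm hzt).eventually (φ.open_source.mem_nhds hzφ)] with s hs hs'
    rw [φ.left_inv hs', ψ.right_inv hs]
  rw [pd_congr he, pd_apply] at h2
  simp only [hy2] at h2
  rw [Matrix.mul_apply, Matrix.one_apply, h2]
  exact Finset.sum_congr rfl fun _ _ => mul_comm _ _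

end TwistedPeriods

end FrobeniusManifold

end FrobeniusGeometry

namespace FrobeniusGeometry

namespace FrobeniusManifold

/-! ### The Hessian formula in the coordinates `z`. -/

section Hessian

variable {n : ℕ} [NeZero n] {M : Type*} [TopologicalSpace M] [ChartedSpace (Model n) M]
  {d ν : ℂ} (F : FrobeniusManifold n M d) {φ ψ : OpenPartialHomeomorph M (Model n)}
  {f : Model n → ℂ}

variable [IsManifold 𝓘(ℂ, Model n) ω M]

theorem analyticAt_mul_lowerT (hφ : F.IsUnitalFlatChart φ) (hψ : IsHolChart ψ)
    (hψφ : ψ.source ⊆ φ.source) {κ : ℂ} (hf : ∀ y, f y = κ * F.lowerT φ (ψ.symm y))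
    {y : Model n} (hy : y ∈ ψ.target) : AnalyticAt ℂ f y := by
  obtain ⟨hχ, A, hA⟩ := hφ.1
  have h1 : AnalyticAt ℂ (fun s => κ * ∑ α, A 0 α * φ (ψ.symm s) α) y :=
    analyticAt_const.mul ((analyticAt_linear (A 0) _).comp
      (analyticAt_transition hψ hχ hy (hψφ (ψ.map_target hy))))
  refine h1.congr ?_
  filter_upwards [ψ.open_target.mem_nhds hy] with s hs
  rw [hf, F.lowerT_eq hA (hψφ (ψ.map_target hs))]

theorem intGram_eq_hessian (hν : ν ≠ (1 - d) / 2) (hφ : F.IsUnitalFlatChart φ)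
    (hψ : IsHolChart ψ) (hψφ : ψ.source ⊆ φ.source)
    (hz : ∀ i, F.IsTwistedPeriodOn ν (fun x => ψ x i) ψ.source)
    (hf : ∀ y, f y = ((1 - d) / 2 - ν)⁻¹ * F.lowerT φ (ψ.symm y)) {z : Model n}
    (hzt : z ∈ ψ.target) (i j : Fin n) : F.intGram ψ z i j = pd i (pd j f) z := by
  obtain ⟨hχ, A, hA⟩ := hφ.1
  have hx := ψ.map_target hzt
  set y := φ (ψ.symm z)
  have hy : y ∈ φ.target := φ.map_source (hψφ hx)
  have hyx : φ.symm y = ψ.symm z := φ.left_inv (hψφ hx)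
  have hy' : φ.symm y ∈ ψ.source := hyx ▸ hx
  have hZy : ψ (φ.symm y) = z := by rw [hyx, ψ.right_inv hzt]
  have hWd : ψ.source ⊆ F.discriminantᶜ := (hz 0).2.1
  have hd := F.eventually_notMem_discriminant ψ.open_source hWd hy hy'
  have hfZ : (fun t => f (ψ (φ.symm t))) =ᶠ[nhds y]
      fun t => ((1 - d) / 2 - ν)⁻¹ * ∑ α, A 0 α * t α := by
    filter_upwards [φ.open_target.mem_nhds hy,
      (φ.continuousAt_symm hy).eventually (ψ.open_source.mem_nhds hy')] with t ht ht'
    rw [hf, ψ.left_inv ht', F.lowerT_symm hA ht]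
  have key := F.sum_hessian_eq_intGram hν hφ hA hy hd (analyticAt_transition hχ hψ hy hy')
    (F.analyticAt_mul_lowerT hφ hψ hψφ hf (ψ.map_source hy')) hfZ
    (fun i α β => (hz i).2.2.2 φ hχ y hy hy' α β)
  obtain ⟨J, hJ⟩ := exists_jacobian_mul_eq_one hχ hψ hy hy'
  set Z := Matrix.of (fun i α => pd α (fun t => ψ (φ.symm t) i) y) with hZdef
  have hsum : ∀ (H : Fin n → Fin n → ℂ) (α β : Fin n),
      (Z.transpose * Matrix.of H * Z) α β = ∑ i, ∑ j, pd α (fun t => ψ (φ.symm t) i) y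
        * pd β (fun t => ψ (φ.symm t) j) y * H i j := fun H α β => by
    simp only [Matrix.mul_apply, Matrix.transpose_apply, Matrix.of_apply, hZdef, Finset.sum_mul]
    rw [Finset.sum_comm]
    exact Finset.sum_congr rfl fun _ _ => Finset.sum_congr rfl fun _ _ => by ring
  -- Both matrices have the same pullback to the flat chart, one by the Hessian computation and the
  -- other by tensoriality of `tanForm`; the invertible Jacobian then cancels.
  have hM : Z.transpose * Matrix.of (fun i j => pd i (pd j f) z) * Z
      = Z.transpose * Matrix.of (fun i j => gram F.tanForm ψ i j z) * Z := by
    ext α β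
    have h1 := key α β
    rw [hZy] at h1
    rw [hsum, hsum, h1, F.intGram_eq hχ hy hd.self_of_nhds, gram_change hχ hψ _ hy hy', hZy]
  have hJt : J.transpose * Z.transpose = 1 := by
    rw [← Matrix.transpose_mul, hJ, Matrix.transpose_one]
  have hcancel : ∀ H : Matrix (Fin n) (Fin n) ℂ, H = J.transpose * (Z.transpose * H * Z) * J :=
    fun H => by
      calc H = (J.transpose * Z.transpose) * H * (Z * J) := by rw [hJt, hJ, one_mul, mul_one]
        _ = _ := by simp only [mul_assoc]
  have hH : Matrix.of (fun i j => pd i (pd j f) z)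
      = Matrix.of (fun i j => gram F.tanForm ψ i j z) := by
    rw [hcancel (Matrix.of fun i j => pd i (pd j f) z), hM, ← hcancel]
  rw [F.intGram_eq hψ hzt (hWd hx)]
  exact (congrFun (congrFun hH i) j).symm

end Hessian

end FrobeniusManifold

end FrobeniusGeometry

/-! ### The main theorem. -/

open FrobeniusGeometry FrobeniusManifold in
theorem mainTheorem12 {n : ℕ} [NeZero n] {M : Type*} [TopologicalSpace M]
    [ChartedSpace (Model n) M] [IsManifold 𝓘(ℂ, Model n) ω M]
    {d : ℂ} (hd : d ≠ 1) (F : FrobeniusManifold n M d)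
    (ν : ℂ) (hν : ν ≠ (1 - d) / 2)
    -- flat coordinates `t`
    (φ : OpenPartialHomeomorph M (Model n)) (hφ : F.IsUnitalFlatChart φ)
    -- coordinates `z` consisting of twisted periods
    (ψ : OpenPartialHomeomorph M (Model n)) (hψ : IsHolChart ψ) (hψφ : ψ.source ⊆ φ.source)
    (hz : ∀ i, F.IsTwistedPeriodOn ν (fun x => ψ x i) ψ.source)
    -- the function `f(z)`
    (f : Model n → ℂ) (hf : ∀ y, f y = ((1 - d) / 2 - ν)⁻¹ * F.lowerT φ (ψ.symm y)) :
    -- the intersection form is the Hessian of `f`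
    (AnalyticOnNhd ℂ f ψ.target ∧
      ∀ y ∈ ψ.target, ∀ i j, F.intGram ψ y i j = pd i (pd j f) y) ∧
    -- the constants in `t_1` and `z` can be chosen so that these functions are quasihomogeneous
    (IsPreconnected ψ.source →
      (∃ a : ℂ, ∀ x ∈ ψ.source,
        F.lieE (fun x' => F.lowerT φ x' + a) x = (1 - d) * (F.lowerT φ x + a)) ∧
      ((1 - d) / 2 + ν ≠ 0 → ∀ i, ∃ b : ℂ, ∀ x ∈ ψ.source,
        F.lieE (fun x' => ψ x' i + b) x = ((1 - d) / 2 + ν) * (ψ x i + b))) ∧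
    -- and with this choice `f` is homogeneous
    ((1 - d) / 2 + ν ≠ 0 →
      (∀ x ∈ ψ.source, F.lieE (F.lowerT φ) x = (1 - d) * F.lowerT φ x) →
      (∀ i, ∀ x ∈ ψ.source,
        F.lieE (fun x' => ψ x' i) x = ((1 - d) / 2 + ν) * ψ x i) →
      IsHomogeneousOn f ψ.target ((1 - d) / ((1 - d) / 2 + ν))) := by 
  obtain ⟨hχ, A, hA⟩ := hφ.1
  have hk : 1 - d ≠ 0 := sub_ne_zero.2 hd.symm
  have hWd : ψ.source ⊆ F.discriminantᶜ := (hz 0).2.1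
  have himage : ∀ y ∈ φ '' ψ.source, y ∈ φ.target ∧ φ.symm y ∈ ψ.source := by
    rintro _ ⟨x, hx, rfl⟩
    exact ⟨φ.map_source (hψφ hx), by rwa [φ.left_inv (hψφ hx)]⟩
  refine ⟨⟨fun y hy => F.analyticAt_mul_lowerT hφ hψ hψφ hf hy,
    fun y hy i j => F.intGram_eq_hessian hν hφ hψ hψφ hz hf hy i j⟩, fun hconn => ⟨?_, ?_⟩, ?_⟩
  · refine F.exists_lieE_add_const hχ ψ.open_source hψφ hconn hk
      (fun x hx => F.mdifferentiableAt_lowerT hχ hA (hψφ hx)) (fun y hy => ?_)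
      fun y hy β => F.pd_lie_lowerT hφ hA (himage y hy).1 β
    exact (analyticAt_linear (A 0) y).congr
      (F.lowerT_comp_symm_eventuallyEq hA (himage y hy).1).symm
  · intro hk' i
    have hP : ∀ y ∈ φ '' ψ.source, AnalyticAt ℂ ((fun x => ψ x i) ∘ φ.symm) y := fun y hy =>
      ((ContinuousLinearMap.proj (R := ℂ) (φ := fun _ : Fin n => ℂ) i).analyticAt _).comp
        (analyticAt_transition hχ hψ (himage y hy).1 (himage y hy).2)
    refine F.exists_lieE_add_const hχ ψ.open_source hψφ hconn hk'
      (fun x hx => hψ.mdifferentiableAt_apply hx i) hP fun y hy β => ?_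
    obtain ⟨hy1, hy2⟩ := himage y hy
    exact F.pd_lie_twisted hφ hy1
      (F.eventually_notMem_discriminant ψ.open_source hWd hy1 hy2) (hP y hy)
      (fun α β => (hz i).2.2.2 φ hχ y hy1 hy2 α β) β
  · intro hk' ht hzE
    refine isHomogeneousOn_of_euler
      (fun y hy => (F.analyticAt_mul_lowerT hφ hψ hψφ hf hy).differentiableAt) fun y hy => ?_
    have hx := ψ.map_target hy
    have h1 := F.lieE_eq_sum hψ hy (F.mdifferentiableAt_lowerT hχ hA (hψφ hx))
    -- The components of `E` in the chart `z` are `Lie_E z^i`, so the normalization makes `E` a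
    -- multiple of the radial field.
    have h2 : ∀ i, vecComp F.euler ψ i y = ((1 - d) / 2 + ν) * y i := fun i => by
      have := hzE i _ hx
      rw [lieE, ← coordDiff_eq_mfderiv hψ hx, ψ.right_inv hy] at this
      exact this
    have hT : F.lowerT φ ∘ ψ.symm = fun s => ((1 - d) / 2 - ν) * f s := by
      funext s
      rw [hf, ← mul_assoc, mul_inv_cancel₀ (sub_ne_zero.2 hν.symm), one_mul]
      rfl
    have h3 : F.lowerT φ (ψ.symm y) = ((1 - d) / 2 - ν) * f y := congrFun hT y
    rw [ht _ hx, hT, h3] at h1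
    simp only [pd_const_mul _ (F.analyticAt_mul_lowerT hφ hψ hψφ hf hy).differentiableAt, h2] at h1
    -- Euler's identity for `f`, after cancelling the nonzero factor relating `t_1` to `f`.
    have h4 : ((1 - d) / 2 + ν) * ∑ i, y i * pd i f y = (1 - d) * f y := by
      refine mul_left_cancel₀ (sub_ne_zero.2 hν.symm) ?_
      calc _ = ∑ i, ((1 - d) / 2 + ν) * y i * (((1 - d) / 2 - ν) * pd i f y) := by
            simp only [Finset.mul_sum]
            exact Finset.sum_congr rfl fun _ _ => by ring
        _ = _ := by rw [← h1]; ring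
    rw [div_mul_eq_mul_div, eq_div_iff hk', mul_comm, h4]
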